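/- Let $l\ge 3$ and $k\ge 1$ be integers with $4\mid k$, put $n_1=2^{l-1}+1$, $n_2=2^{l-1}-1$, and let $$G=\mathbb Z_{2^l}\rtimes D_k=\langle a,u,v \mid a^{2^l}=u^k=v^2=1,\ uau^{-1}=a^{n_1},\ vav=a^{n_2},\ vuv=u^{-1}\rangle ,$$ a group of order $2^{l+1}k$. Let $D(G)=(\mathbb C^G)^{\mathrm{cop}}\otimes\mathbb C G$ be its Drinfel'd double over $\mathbb C$, with the multiplication given by the conjugation action of $G$ on $\mathbb C^G$, and let $\Lambda$ be the integral of $D(G)$ with $\varepsilon(\Lambda)=1$. For a finite-dimensional $D(G)$-module $V$ with character $\chi$ and $m\in\mathbb N$ let $\nu_m(V)=\chi(\Lambda^{[m]})$, where $\Lambda^{[m]}=\sum \Lambda_1\Lambda_2\cdots\Lambda_m$ in Sweedler notation. For $g\in G$ and a representation $\rho$ of the centralizer $C_G(g)$ on $W$, let $M(\mathrm{class}(g),\rho)=\bigoplus_q g_q\otimes W$, where $g_q$ runs over representatives of the left cosets of $C_G(g)$ in $G$; here $h\in G$ acts by $h\cdot g_qw=g_{q'}(\gamma w)$ if $hg_q=g_{q'}\gamma$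 with $\gamma\in C_G(g)$, and $p_x\in\mathbb C^G$ (the dual basis element of $x\in G$) acts as the projection onto the sum of the $g_q\otimes W$ with $g_q\,g\,g_q^{-1}=x$. Let $r,i,s,t\in\mathbb Z$ with $r$ odd. Then $C_G(a^ru^{2i})=\langle a,u^2\rangle=\langle a\rangle\times\langle u^2\rangle$. Let $\alpha$ and $\beta$ be generators of the groups of linear characters of $\langle a\rangle$ and $\langle u^2\rangle$, and let $\phi_{s,t}=\alpha^s\otimes\beta^t$, a linear character of $C_G(a^ru^{2i})$. Then $V=M(\mathrm{class}(a^ru^{2i}),\phi_{s,t})$ is a 4-dimensional irreducible $D(G)$-module, and for every integer $m>1$ $$\nu_m(V)=\begin{cases}4 & \text{if } 2^l\mid m,\ k\mid 2mi \text{ and } k\mid mt,\\ 2 & \text{if } 4\mid m \text{ and } (2^l\nmid m \text{ or } k\nmid 2mi \text{ or } k\nmid mt),\\ 1 & \text{if } 2\mid m \text{ and } 4\nmid m,\\ 0 & \text{if } 2\nmid m.\end{cases}$$ In particular $\nu_2(V)=1$. -/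

import Mathlib

open scoped TensorProduct

set_option linter.unusedSectionVars false

noncomputable section

namespace DoubleIndicator

/-! ### Normalized integrals, Sweedler powers and higher indicators -/

section Hopf

/-- `Λ` is a two-sided integral with `ε(Λ) = 1`. -/
structure IsNormalizedIntegral {H : Type*} [Ring H] [HopfAlgebra ℂ H] (Λ : H) : Prop where
  left : ∀ h : H, h * Λ = (Coalgebra.counit (R := ℂ) h : ℂ) • Λ
  right : ∀ h : H, Λ * h = (Coalgebra.counit (R := ℂ) h : ℂ) • Λ
  counit_eq_one : (Coalgebra.counit (R := ℂ) Λ : ℂ) = 1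

theorem IsNormalizedIntegral.unique {H : Type*} [Ring H] [HopfAlgebra ℂ H] {Λ Λ' : H}
    (h : IsNormalizedIntegral Λ) (h' : IsNormalizedIntegral Λ') : Λ = Λ' := by
  have h1 := h.left Λ'
  have h2 := h'.right Λ
  rw [h'.counit_eq_one, one_smul] at h1
  rw [h.counit_eq_one, one_smul] at h2
  exact h1.symm.trans h2

/-- The Sweedler power `x ↦ x^{[m]} = ∑ x₁ x₂ ⋯ x_m`, that is, the `m`-th power of the identity
map for the convolution product. -/
def sweedlerPower {H : Type*} [Ring H] [HopfAlgebra ℂ H] (m : ℕ) (x : H) : H :=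
  ((WithConv.toConv (LinearMap.id : H →ₗ[ℂ] H)) ^ m).ofConv x

/-- The character of an `H`-module. -/
def character {H : Type*} [Ring H] [HopfAlgebra ℂ H] (V : Type*) [AddCommGroup V] [Module ℂ V]
    [Module H V] [IsScalarTower ℂ H V] (x : H) : ℂ :=
  LinearMap.trace ℂ V (Algebra.lsmul ℂ ℂ V x)

end Hopf

/-! ### The Drinfel'd double of a finite group -/

/-- The Drinfel'd double of `G`, with basis `p_g ⋈ h` indexed by the pairs `(g, h)`, where `p_g`
is the basis of the linear dual of `ℂ[G]` that is dual to the group elements. -/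
def DrinfeldDouble (G : Type*) : Type _ := (G × G) →₀ ℂ

namespace DrinfeldDouble

instance (G : Type*) : AddCommGroup (DrinfeldDouble G) :=
  inferInstanceAs (AddCommGroup ((G × G) →₀ ℂ))

instance (G : Type*) : Module ℂ (DrinfeldDouble G) :=
  inferInstanceAs (Module ℂ ((G × G) →₀ ℂ))

/-- The basis element `p_g ⋈ h`. -/
def e {G : Type*} (g h : G) : DrinfeldDouble G := Finsupp.single (g, h) 1

/-- The linear map with prescribed values on the basis `p_g ⋈ h`. -/
def lift {G M : Type*} [AddCommMonoid M] [Module ℂ M] (f : G → G → M) :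
    DrinfeldDouble G →ₗ[ℂ] M :=
  Finsupp.linearCombination ℂ (fun p : G × G => f p.1 p.2)

@[simp]
theorem lift_e {G M : Type*} [AddCommMonoid M] [Module ℂ M] (f : G → G → M) (g h : G) :
    lift f (e g h) = f g h := by
  unfold lift e
  erw [Finsupp.linearCombination_single]
  simp

theorem hom_ext {G M : Type*} [AddCommMonoid M] [Module ℂ M] {f f' : DrinfeldDouble G →ₗ[ℂ] M}
    (h : ∀ x y, f (e x y) = f' (e x y)) : f = f' := by
  refine Finsupp.lhom_ext' (M := ℂ) (fun p => ?_)
  refine LinearMap.ext_ring ?_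
  exact h p.1 p.2

theorem induction {G : Type*} {p : DrinfeldDouble G → Prop} (x : DrinfeldDouble G)
    (zero : p 0) (basis : ∀ g h, p (e g h)) (add : ∀ x y, p x → p y → p (x + y))
    (smul : ∀ (c : ℂ) x, p x → p (c • x)) : p x := by
  refine Finsupp.induction_linear x zero add (fun a b => ?_)
  have := smul b _ (basis a.1 a.2)
  have h2 : (b • e a.1 a.2 : DrinfeldDouble G) = Finsupp.single a b :=
    (Finsupp.smul_single b a (1 : ℂ)).trans (by rw [smul_eq_mul, mul_one])
  rwa [h2] at this

section Mul

variable {G : Type*} [Group G] [DecidableEq G]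

/-- The product, `(p_g ⋈ h)(p_{g'} ⋈ h') = δ_{g, h g' h⁻¹} p_g ⋈ h h'`. -/
def mulMap : DrinfeldDouble G →ₗ[ℂ] DrinfeldDouble G →ₗ[ℂ] DrinfeldDouble G :=
  lift fun g h => lift fun g' h' => if g = h * g' * h⁻¹ then e g (h * h') else 0

instance : Mul (DrinfeldDouble G) := ⟨fun x y => mulMap x y⟩

theorem mul_def (x y : DrinfeldDouble G) : x * y = mulMap x y := rfl

theorem e_mul_e (g h g' h' : G) :
    (e g h * e g' h' : DrinfeldDouble G) = if g = h * g' * h⁻¹ then e g (h * h') else 0 := by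
  simp [mul_def, mulMap]

variable [Fintype G]

instance : One (DrinfeldDouble G) := ⟨∑ g, e g 1⟩

theorem one_def : (1 : DrinfeldDouble G) = ∑ g, e g 1 := rfl

instance : Ring (DrinfeldDouble G) where
  __ := (inferInstance : AddCommGroup (DrinfeldDouble G))
  left_distrib x y z := by simp [mul_def]
  right_distrib x y z := by simp [mul_def]
  zero_mul x := by simp [mul_def]
  mul_zero x := by simp [mul_def]
  mul_assoc x y z := by
    simp only [mul_def]
    induction x using induction with
    | zero => simp
    | add a b ha hb => simp [ha, hb]
    | smul c a ha => simp [ha]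
    | basis g h =>
      induction y using induction with
      | zero => simp
      | add a b ha hb => simp [ha, hb]
      | smul c a ha => simp [ha]
      | basis g' h' =>
        induction z using induction with
        | zero => simp
        | add a b ha hb => simp [ha, hb]
        | smul c a ha => simp [ha]
        | basis g'' h'' =>
          simp only [← mul_def, e_mul_e]
          by_cases h2 : g' = h' * g'' * h'⁻¹
          · by_cases h1 : g = h * g' * h⁻¹
            · subst h1 h2
              simp [mul_def, mulMap, mul_assoc]
            · rw [if_neg h1, if_pos h2, e_mul_e, mul_def, map_zero, LinearMap.zero_apply,
                if_neg h1]
          · rw [if_neg h2, mul_def _ 0, map_zero]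
            by_cases h1 : g = h * g' * h⁻¹
            · rw [if_pos h1, e_mul_e, if_neg]
              intro hh
              apply h2
              have h3 : h * g' * h⁻¹ = h * (h' * g'' * h'⁻¹) * h⁻¹ := by
                rw [← h1, hh]
                group
              exact mul_left_cancel (mul_right_cancel h3)
            · rw [if_neg h1, mul_def 0, map_zero, LinearMap.zero_apply]
  one_mul x := by
    simp only [mul_def]
    induction x using induction with
    | zero => simp
    | add a b ha hb => simp [ha, hb]
    | smul c a ha => simp [ha]
    | basis g h => simp [one_def, mulMap]
  mul_one x := by
    simp only [mul_def]
    induction x using induction with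
    | zero => simp
    | add a b ha hb => simp [ha, hb]
    | smul c a ha => simp [ha]
    | basis g h =>
      simp only [one_def, map_sum, ← mul_def, e_mul_e]
      rw [Finset.sum_eq_single (h⁻¹ * g * h)]
      · simp [mul_assoc]
      · intro b _ hb
        refine if_neg fun hh => hb ?_
        rw [hh]
        group
      · simp

instance : Algebra ℂ (DrinfeldDouble G) :=
  Algebra.ofModule (fun r x y => by simp [mul_def]) (fun r x y => by simp [mul_def])

/-- The counit, `ε(p_g ⋈ h) = δ_{g, 1}`. -/
def counitMap : DrinfeldDouble G →ₗ[ℂ] ℂ := lift fun g _ => if g = 1 then 1 else 0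

/-- The coproduct of `(ℂ^G)^cop ⊗ ℂ[G]`,
`Δ(p_g ⋈ h) = ∑_{x y = g} (p_y ⋈ h) ⊗ (p_x ⋈ h)`. -/
def comulMap : DrinfeldDouble G →ₗ[ℂ] DrinfeldDouble G ⊗[ℂ] DrinfeldDouble G :=
  lift fun g h => ∑ x : G, e (x⁻¹ * g) h ⊗ₜ[ℂ] e x h

/-- The antipode, `S(p_g ⋈ h) = p_{h⁻¹ g⁻¹ h} ⋈ h⁻¹`. -/
def antipodeMap : DrinfeldDouble G →ₗ[ℂ] DrinfeldDouble G :=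
  lift fun g h => e (h⁻¹ * g⁻¹ * h) h⁻¹

instance : Coalgebra ℂ (DrinfeldDouble G) where
  comul := comulMap
  counit := counitMap
  coassoc := by
    refine hom_ext fun g h => ?_
    simp only [comulMap, LinearMap.comp_apply, lift_e, map_sum, LinearMap.rTensor_tmul,
      LinearMap.lTensor_tmul, TensorProduct.sum_tmul, TensorProduct.tmul_sum,
      LinearEquiv.coe_coe, TensorProduct.assoc_tmul]
    rw [Finset.sum_comm (f := fun x y => e (x⁻¹ * g) h ⊗ₜ[ℂ] (e (y⁻¹ * x) h ⊗ₜ[ℂ] e y h))]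
    refine Finset.sum_congr rfl fun x _ => ?_
    refine Fintype.sum_equiv (Equiv.mulLeft x) _ _ fun y => ?_
    simp [mul_assoc]
  rTensor_counit_comp_comul := by
    refine hom_ext fun g h => ?_
    simp only [comulMap, counitMap, LinearMap.comp_apply, lift_e, map_sum,
      LinearMap.rTensor_tmul]
    rw [Finset.sum_eq_single g]
    · simp
    · intro b _ hb
      rw [if_neg (fun hh => hb (inv_mul_eq_one.mp hh)), TensorProduct.zero_tmul]
    · simp
  lTensor_counit_comp_comul := by
    refine hom_ext fun g h => ?_
    simp only [comulMap, counitMap, LinearMap.comp_apply, lift_e, map_sum,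
      LinearMap.lTensor_tmul]
    rw [Finset.sum_eq_single 1] <;> simp +contextual

theorem counit_e (g h : G) :
    (Coalgebra.counit (R := ℂ) (e g h) : ℂ) = if g = 1 then 1 else 0 :=
  lift_e _ g h

theorem comul_e (g h : G) :
    Coalgebra.comul (R := ℂ) (e g h) = ∑ x : G, e (x⁻¹ * g) h ⊗ₜ[ℂ] e x h :=
  lift_e _ g h

theorem counit_mul (x y : DrinfeldDouble G) : (Coalgebra.counit (R := ℂ) (x * y) : ℂ) =
    Coalgebra.counit (R := ℂ) x * Coalgebra.counit (R := ℂ) y := by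
  induction x using induction with
  | zero => simp
  | add a b ha hb => simp [ha, hb, add_mul]
  | smul c a ha => simp [ha, mul_assoc]
  | basis g h =>
    induction y using induction with
    | zero => simp
    | add a b ha hb => simp [ha, hb, mul_add]
    | smul c a ha => simp [ha, mul_left_comm]
    | basis g' h' =>
      rw [e_mul_e, counit_e, counit_e]
      by_cases h1 : g = h * g' * h⁻¹
      · subst h1
        simp [counit_e]
      · rw [if_neg h1, map_zero]
        by_cases h2 : g' = 1
        · subst h2
          simp at h1
          simp [h1]
        · simp [h2]

theorem comul_mul (x y : DrinfeldDouble G) : Coalgebra.comul (R := ℂ) (x * y) =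
    Coalgebra.comul (R := ℂ) x * Coalgebra.comul (R := ℂ) y := by
  induction x using induction with
  | zero => simp
  | add a b ha hb => simp [ha, hb, add_mul]
  | smul c a ha => rw [smul_mul_assoc, map_smul, map_smul, ha]; exact (Algebra.smul_mul_assoc _ _ _).symm
  | basis g h =>
    induction y using induction with
    | zero => simp
    | add a b ha hb => simp [ha, hb, mul_add]
    | smul c a ha => rw [mul_smul_comm, map_smul, map_smul, ha]; exact (Algebra.mul_smul_comm _ _ _).symm
    | basis g' h' =>
      rw [e_mul_e, comul_e, comul_e, Finset.sum_mul_sum]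
      simp only [Algebra.TensorProduct.tmul_mul_tmul, e_mul_e]
      by_cases h1 : g = h * g' * h⁻¹
      · subst h1
        rw [if_pos rfl, comul_e]
        refine Finset.sum_congr rfl fun x _ => ?_
        rw [Finset.sum_eq_single (h⁻¹ * x * h)]
        · simp [mul_assoc]
        · intro b _ hb
          rw [if_neg (fun hh : x = h * b * h⁻¹ => hb (by rw [hh]; group)),
            TensorProduct.tmul_zero]
        · simp
      · rw [if_neg h1, map_zero]
        symm
        refine Finset.sum_eq_zero fun x _ => Finset.sum_eq_zero fun y _ => ?_
        by_cases h2 : x = h * y * h⁻¹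
        · rw [if_neg, TensorProduct.zero_tmul]
          intro h3
          apply h1
          rw [inv_mul_eq_iff_eq_mul] at h3
          rw [h3, h2]
          group
        · rw [if_neg h2, TensorProduct.tmul_zero]

instance : Bialgebra ℂ (DrinfeldDouble G) :=
  Bialgebra.mk' ℂ (DrinfeldDouble G)
    (by simp [one_def, counit_e])
    (fun {x y} => counit_mul x y)
    (by
      rw [one_def, map_sum, Algebra.TensorProduct.one_def, one_def, TensorProduct.sum_tmul]
      simp only [TensorProduct.tmul_sum, comul_e]
      rw [Finset.sum_comm, Finset.sum_comm (f := fun x y : G => e x (1 : G) ⊗ₜ[ℂ] e y (1 : G))]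
      refine Finset.sum_congr rfl fun x _ => ?_
      exact Fintype.sum_equiv (Equiv.mulLeft x⁻¹) _ _ fun y => rfl)
    (fun {x y} => comul_mul x y)

instance : HopfAlgebra ℂ (DrinfeldDouble G) where
  antipode := antipodeMap
  mul_antipode_rTensor_comul := by
    refine hom_ext fun g h => ?_
    simp only [LinearMap.comp_apply, comul_e, map_sum, LinearMap.rTensor_tmul,
      LinearMap.mul'_apply, counit_e, antipodeMap, lift_e, e_mul_e, Algebra.linearMap_apply]
    by_cases h1 : g = 1
    · subst h1
      rw [if_pos rfl, map_one, one_def]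
      refine Fintype.sum_equiv (MulAut.conj h⁻¹).toEquiv _ _ fun x => ?_
      simp
    · rw [if_neg h1, map_zero]
      refine Finset.sum_eq_zero fun x _ => if_neg fun h2 => h1 ?_
      simpa [mul_assoc] using h2
  mul_antipode_lTensor_comul := by
    refine hom_ext fun g h => ?_
    simp only [LinearMap.comp_apply, comul_e, map_sum, LinearMap.lTensor_tmul,
      LinearMap.mul'_apply, counit_e, antipodeMap, lift_e, e_mul_e, Algebra.linearMap_apply]
    by_cases h1 : g = 1
    · subst h1
      rw [if_pos rfl, map_one, one_def]
      refine Fintype.sum_equiv (Equiv.inv G) _ _ fun x => ?_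
      simp [mul_assoc]
    · rw [if_neg h1, map_zero]
      refine Finset.sum_eq_zero fun x _ => if_neg fun h2 => h1 ?_
      simpa [mul_assoc] using h2

/-- `|G|⁻¹ ∑_h p_1 ⋈ h` is a normalized integral. -/
theorem isNormalizedIntegral :
    IsNormalizedIntegral ((Fintype.card G : ℂ)⁻¹ • ∑ h : G, (e 1 h : DrinfeldDouble G)) where
  left x := by
    rw [mul_smul_comm, smul_comm]
    congr 1
    induction x using induction with
    | zero => simp
    | add a b ha hb => simp only [add_mul, ha, hb, map_add, add_smul]
    | smul c a ha => simp only [smul_mul_assoc, ha, map_smul, smul_smul, smul_eq_mul]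
    | basis g h =>
      rw [Finset.mul_sum, counit_e]
      simp only [e_mul_e, mul_one, mul_inv_cancel]
      by_cases h1 : g = 1
      · subst h1
        simp only [if_true, one_smul]
        exact Fintype.sum_equiv (Equiv.mulLeft h) _ _ fun y => rfl
      · simp [h1]
  right x := by
    rw [smul_mul_assoc, smul_comm]
    congr 1
    induction x using induction with
    | zero => simp
    | add a b ha hb => simp only [mul_add, ha, hb, map_add, add_smul]
    | smul c a ha => simp only [mul_smul_comm, ha, map_smul, smul_smul, smul_eq_mul]
    | basis g h =>
      rw [Finset.sum_mul, counit_e]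
      simp only [e_mul_e]
      by_cases h1 : g = 1
      · subst h1
        simp only [mul_one, mul_inv_cancel, if_true, one_smul]
        exact Fintype.sum_equiv (Equiv.mulRight h) _ _ fun y => rfl
      · rw [if_neg h1, zero_smul]
        refine Finset.sum_eq_zero fun y _ => if_neg fun h2 => h1 ?_
        have := congrArg (fun z => y⁻¹ * z * y) h2
        simpa [mul_assoc] using this.symm
  counit_eq_one := by
    simp [counit_e]

theorem exists_isNormalizedIntegral : ∃ Λ : DrinfeldDouble G, IsNormalizedIntegral Λ :=
  ⟨_, isNormalizedIntegral⟩

variable (G) in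
/-- The integral of the double with `ε(Λ) = 1`. -/
def integral : DrinfeldDouble G := Classical.choose (exists_isNormalizedIntegral (G := G))

theorem integral_spec : IsNormalizedIntegral (integral G) :=
  Classical.choose_spec exists_isNormalizedIntegral

variable (G) in
/-- The `m`-th indicator `ν_m(V) = χ_V(Λ^{[m]})` of a module over the double of `G`. -/
def indicator (V : Type*) [AddCommGroup V] [Module ℂ V] [Module (DrinfeldDouble G) V]
    [IsScalarTower ℂ (DrinfeldDouble G) V] (m : ℕ) : ℂ :=
  character V (sweedlerPower m (integral G))

end Mul

end DrinfeldDouble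

/-! ### The modules `M(class(s), ρ)` -/

section DoubleModule

variable {G : Type*} [Group G] {W : Type*} [AddCommGroup W] [Module ℂ W]

/-- The element `γ` of the centralizer of `s` with `g g_q = g_{g q} γ`, where `g_q` denotes the
chosen representative of the coset `q`. -/
def cosetCocycle (s g : G) (q : G ⧸ Subgroup.centralizer {s}) : Subgroup.centralizer {s} :=
  ⟨(g • q).out⁻¹ * (g * q.out), by
    rw [← QuotientGroup.eq, QuotientGroup.out_eq']
    conv_lhs => rw [← QuotientGroup.out_eq' q]
    rfl⟩

/-- The conjugate `t_q = g_q s g_q⁻¹` of `s` attached to the coset `q`. -/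
def cosetConj (s : G) (q : G ⧸ Subgroup.centralizer {s}) : G := q.out * s * q.out⁻¹

theorem cosetCocycle_one (s : G) (q : G ⧸ Subgroup.centralizer {s}) :
    cosetCocycle s 1 q = 1 := by
  apply Subtype.ext
  simp [cosetCocycle]

theorem cosetCocycle_mul (s g h : G) (q : G ⧸ Subgroup.centralizer {s}) :
    cosetCocycle s (g * h) q = cosetCocycle s g (h • q) * cosetCocycle s h q := by
  apply Subtype.ext
  simp [cosetCocycle, mul_smul, mul_assoc]

theorem cosetConj_smul (s g : G) (q : G ⧸ Subgroup.centralizer {s}) :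
    cosetConj s (g • q) = g * cosetConj s q * g⁻¹ := by
  have h := Subgroup.mem_centralizer_singleton_iff.mp (cosetCocycle s g q).2
  simp only [cosetCocycle] at h
  have h2 : g * q.out = (g • q).out * ((g • q).out⁻¹ * (g * q.out)) := by group
  have h3 : g * cosetConj s q * g⁻¹ = (g * q.out) * s * (g * q.out)⁻¹ := by
    simp [cosetConj, mul_assoc]
  rw [h3, h2]
  generalize (g • q).out⁻¹ * (g * q.out) = c at h
  have h4 : c * s * c⁻¹ = s := by rw [h]; group
  calc (g • q).out * s * (g • q).out⁻¹ = (g • q).out * (c * s * c⁻¹) * (g • q).out⁻¹ := by rw [h4]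
    _ = _ := by group

/-- The space `⨁_q g_q ⊗ W` underlying `M(class(s), ρ)`; here `q` runs through the left cosets of
the centralizer of `s`, and `Finsupp.single q w` is the element `g_q w`. -/
def DoubleModule (s : G) (_ρ : Representation ℂ (Subgroup.centralizer {s}) W) : Type _ :=
  (G ⧸ Subgroup.centralizer {s}) →₀ W

namespace DoubleModule

variable (s : G) (ρ : Representation ℂ (Subgroup.centralizer {s}) W)

instance : AddCommGroup (DoubleModule s ρ) :=
  inferInstanceAs (AddCommGroup ((G ⧸ Subgroup.centralizer {s}) →₀ W))

instance : Module ℂ (DoubleModule s ρ) :=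
  inferInstanceAs (Module ℂ ((G ⧸ Subgroup.centralizer {s}) →₀ W))

/-- The inclusion `w ↦ g_q w` of the summand indexed by `q`. -/
def of (q : G ⧸ Subgroup.centralizer {s}) : W →ₗ[ℂ] DoubleModule s ρ := Finsupp.lsingle q

variable {s ρ} in
theorem hom_ext {M : Type*} [AddCommMonoid M] [Module ℂ M] {f f' : DoubleModule s ρ →ₗ[ℂ] M}
    (h : ∀ q w, f (of s ρ q w) = f' (of s ρ q w)) : f = f' :=
  Finsupp.lhom_ext' fun q => LinearMap.ext (h q)

variable [DecidableEq G]

/-- The action of `p_g ⋈ h`: the element `h` sends `g_q w` to `g_{h q} (γ w)`, which has degree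
`t_{h q}`, and `p_g` is the projection onto the part of degree `g`. -/
def basisAction (g h : G) : Module.End ℂ (DoubleModule s ρ) :=
  Finsupp.lsum ℂ fun q =>
    if cosetConj s (h • q) = g then of s ρ (h • q) ∘ₗ ρ (cosetCocycle s h q) else 0

theorem basisAction_of (g h : G) (q : G ⧸ Subgroup.centralizer {s}) (w : W) :
    basisAction s ρ g h (of s ρ q w) =
      if cosetConj s (h • q) = g then of s ρ (h • q) (ρ (cosetCocycle s h q) w) else 0 := by
  refine (Finsupp.lsum_single ℂ _ q w).trans ?_
  split_ifs <;> rfl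

variable [Fintype G]

/-- The action of the double as an algebra homomorphism. -/
def action : DrinfeldDouble G →ₐ[ℂ] Module.End ℂ (DoubleModule s ρ) :=
  AlgHom.ofLinearMap (DrinfeldDouble.lift (basisAction s ρ))
    (by
      refine hom_ext fun q w => ?_
      simp [DrinfeldDouble.one_def, basisAction_of, cosetCocycle_one])
    (fun x y => by
      induction x using DrinfeldDouble.induction with
      | zero => simp
      | add a b ha hb => simp [ha, hb, add_mul]
      | smul c a ha => simp [ha]
      | basis g h =>
        induction y using DrinfeldDouble.induction with
        | zero => simp
        | add a b ha hb => simp [ha, hb, mul_add]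
        | smul c a ha => simp [ha]
        | basis g' h' =>
          refine hom_ext fun q w => ?_
          rw [DrinfeldDouble.e_mul_e, Module.End.mul_apply, DrinfeldDouble.lift_e,
            DrinfeldDouble.lift_e, basisAction_of]
          by_cases h2 : cosetConj s (h' • q) = g'
          · rw [if_pos h2, basisAction_of, cosetConj_smul s h, h2]
            by_cases h1 : g = h * g' * h⁻¹
            · rw [if_pos h1, if_pos h1.symm, DrinfeldDouble.lift_e, basisAction_of, mul_smul,
                cosetConj_smul s h, h2, if_pos h1.symm, cosetCocycle_mul, map_mul]
              rfl
            · rw [if_neg h1, if_neg (Ne.symm h1), map_zero, LinearMap.zero_apply]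
          · rw [if_neg h2, map_zero]
            by_cases h1 : g = h * g' * h⁻¹
            · rw [if_pos h1, DrinfeldDouble.lift_e, basisAction_of, mul_smul,
                cosetConj_smul s h, if_neg]
              rw [h1]
              exact fun h3 => h2 (mul_left_cancel (mul_right_cancel h3))
            · rw [if_neg h1, map_zero, LinearMap.zero_apply])

instance : Module (DrinfeldDouble G) (DoubleModule s ρ) :=
  Module.compHom (DoubleModule s ρ) (action s ρ).toRingHom

theorem smul_def (x : DrinfeldDouble G) (v : DoubleModule s ρ) : x • v = action s ρ x v := rfl

theorem e_smul_of (g h : G) (q : G ⧸ Subgroup.centralizer {s}) (w : W) :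
    (DrinfeldDouble.e g h : DrinfeldDouble G) • of s ρ q w =
      if cosetConj s (h • q) = g then of s ρ (h • q) (ρ (cosetCocycle s h q) w) else 0 := by
  rw [← basisAction_of, smul_def]
  exact congrArg (fun f => f (of s ρ q w)) (DrinfeldDouble.lift_e (basisAction s ρ) g h)

instance : IsScalarTower ℂ (DrinfeldDouble G) (DoubleModule s ρ) where
  smul_assoc c x v := by simp [smul_def]

end DoubleModule

/-- The one-dimensional representation on `ℂ` with a given linear character. -/
def charRep {H : Type*} [Group H] (χ : H →* ℂˣ) : Representation ℂ H ℂ :=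
  (Algebra.lmul ℂ ℂ : ℂ →* Module.End ℂ ℂ).comp ((Units.coeHom ℂ).comp χ)

theorem charRep_apply {H : Type*} [Group H] (χ : H →* ℂˣ) (h : H) (z : ℂ) :
    charRep χ h z = χ h * z := rfl

end DoubleModule

/-! ### The groups `ℤ_{2^l} ⋊ D_k` -/

section Group

variable (l k : ℕ)

/-- Multiplication by a unit as an automorphism of `ℤ/N`, written multiplicatively. -/
def unitAut (N : ℕ) : (ZMod N)ˣ →* MulAut (Multiplicative (ZMod N)) where
  toFun w :=
    { toFun := fun x => Multiplicative.ofAdd (w * x.toAdd)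
      invFun := fun x => Multiplicative.ofAdd (((w⁻¹ : (ZMod N)ˣ) : ZMod N) * x.toAdd)
      left_inv := fun x => by simp
      right_inv := fun x => by simp
      map_mul' := fun x y => by simp [mul_add] }
  map_one' := by ext; simp
  map_mul' w w' := by ext; simp [mul_assoc]

theorem n1_mul_n1 [hl : Fact (3 ≤ l)] :
    ((2 ^ (l - 1) + 1 : ℕ) : ZMod (2 ^ l)) * ((2 ^ (l - 1) + 1 : ℕ) : ZMod (2 ^ l)) = 1 := by
  obtain ⟨j, rfl⟩ := Nat.exists_eq_add_of_le hl.out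
  have h : ((2 : ZMod (2 ^ (3 + j))) ^ (3 + j)) = 0 := by
    have := ZMod.natCast_self (2 ^ (3 + j))
    push_cast at this
    exact this
  have e1 : 3 + j - 1 = j + 2 := by omega
  rw [e1]
  push_cast
  linear_combination (2 ^ (j + 1) + 1) * h

theorem n2_mul_n2 [hl : Fact (3 ≤ l)] :
    ((2 ^ (l - 1) - 1 : ℕ) : ZMod (2 ^ l)) * ((2 ^ (l - 1) - 1 : ℕ) : ZMod (2 ^ l)) = 1 := by
  obtain ⟨j, rfl⟩ := Nat.exists_eq_add_of_le hl.out
  have h : ((2 : ZMod (2 ^ (3 + j))) ^ (3 + j)) = 0 := by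
    have := ZMod.natCast_self (2 ^ (3 + j))
    push_cast at this
    exact this
  have e1 : 3 + j - 1 = j + 2 := by omega
  rw [e1, Nat.cast_sub Nat.one_le_two_pow]
  push_cast
  linear_combination (2 ^ (j + 1) - 1) * h

/-- `n₁ = 2^{l-1} + 1` as a unit modulo `2^l`. -/
def n1 [Fact (3 ≤ l)] : (ZMod (2 ^ l))ˣ :=
  ⟨(2 ^ (l - 1) + 1 : ℕ), (2 ^ (l - 1) + 1 : ℕ), n1_mul_n1 l, n1_mul_n1 l⟩

/-- `n₂ = 2^{l-1} - 1` as a unit modulo `2^l`. -/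
def n2 [Fact (3 ≤ l)] : (ZMod (2 ^ l))ˣ :=
  ⟨(2 ^ (l - 1) - 1 : ℕ), (2 ^ (l - 1) - 1 : ℕ), n2_mul_n2 l, n2_mul_n2 l⟩

theorem n1_sq [Fact (3 ≤ l)] : n1 l * n1 l = 1 := Units.ext (n1_mul_n1 l)

theorem n2_sq [Fact (3 ≤ l)] : n2 l * n2 l = 1 := Units.ext (n2_mul_n2 l)

theorem n1_pow_val_add [Fact (3 ≤ l)] [hk : Fact (4 ∣ k)] [NeZero k] (i j : ZMod k) :
    n1 l ^ (i + j).val = n1 l ^ i.val * n1 l ^ j.val := by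
  have h : n1 l ^ k = 1 := by
    obtain ⟨c, hc⟩ := hk.out
    rw [hc, pow_mul, show 4 = 2 + 2 from rfl, pow_add, pow_two, n1_sq, one_mul, one_pow]
  rw [ZMod.val_add, ← pow_eq_pow_mod _ h, pow_add]

theorem n1_pow_val_sub [Fact (3 ≤ l)] [hk : Fact (4 ∣ k)] [NeZero k] (i j : ZMod k) :
    n1 l ^ (j - i).val = n1 l ^ i.val * n1 l ^ j.val := by
  have h := n1_pow_val_add l k (j - i) i
  rw [sub_add_cancel] at h
  rw [h, mul_comm, mul_assoc, ← mul_pow, n1_sq, one_pow, mul_one]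

/-- The exponent by which an element of `D_k` acts on `ℤ/2^l`: the rotation `u` acts by `n₁` and
the reflection `v` by `n₂`. -/
def dihedralUnit [Fact (3 ≤ l)] [Fact (4 ∣ k)] [NeZero k] :
    DihedralGroup k →* (ZMod (2 ^ l))ˣ where
  toFun
    | .r i => n1 l ^ i.val
    | .sr i => n2 l * n1 l ^ i.val
  map_one' := by
    change n1 l ^ (0 : ZMod k).val = 1
    simp
  map_mul' := by
    rintro (i | i) (j | j)
    · exact n1_pow_val_add l k i j
    · change n2 l * n1 l ^ (j - i).val = n1 l ^ i.val * (n2 l * n1 l ^ j.val)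
      rw [n1_pow_val_sub, mul_left_comm]
    · change n2 l * n1 l ^ (i + j).val = (n2 l * n1 l ^ i.val) * n1 l ^ j.val
      rw [n1_pow_val_add, mul_assoc]
    · change n1 l ^ (j - i).val = (n2 l * n1 l ^ i.val) * (n2 l * n1 l ^ j.val)
      rw [n1_pow_val_sub, mul_mul_mul_comm, n2_sq, one_mul]

/-- The group `ℤ_{2^l} ⋊ D_k`. -/
abbrev ZD [Fact (3 ≤ l)] [Fact (4 ∣ k)] [NeZero k] : Type :=
  SemidirectProduct (Multiplicative (ZMod (2 ^ l))) (DihedralGroup k)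
    ((unitAut (2 ^ l)).comp (dihedralUnit l k))

namespace ZD

theorem one_lt (k : ℕ) [Fact (4 ∣ k)] [NeZero k] : 1 < k := by
  have h : 4 ∣ k := Fact.out
  have h0 : k ≠ 0 := NeZero.ne k
  omega

variable [Fact (3 ≤ l)] [Fact (4 ∣ k)] [NeZero k]

instance : Fintype (ZD l k) :=
  Fintype.ofEquiv (Multiplicative (ZMod (2 ^ l)) × DihedralGroup k)
    SemidirectProduct.equivProd.symm

/-- The generator `a`. -/
def a : ZD l k := SemidirectProduct.inl (Multiplicative.ofAdd 1)

/-- The generator `u`. -/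
def u : ZD l k := SemidirectProduct.inr (DihedralGroup.r 1)

/-- The generator `v`. -/
def v : ZD l k := SemidirectProduct.inr (DihedralGroup.sr 0)

theorem inl_eq (x : Multiplicative (ZMod (2 ^ l))) :
    (SemidirectProduct.inl x : ZD l k) = a l k ^ x.toAdd.val := by
  rw [a, ← map_pow, ← ofAdd_nsmul]
  simp

theorem inr_r_eq (y : ZMod k) :
    (SemidirectProduct.inr (DihedralGroup.r y) : ZD l k) = u l k ^ y.val := by
  rw [u, ← map_pow, DihedralGroup.r_one_pow]
  simp

theorem inr_sr_eq (y : ZMod k) :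
    (SemidirectProduct.inr (DihedralGroup.sr y) : ZD l k) = v l k * u l k ^ y.val := by
  rw [← inr_r_eq, v, ← map_mul]
  simp

/-- The defining relations of the presentation
`⟨a, u, v | a^{2^l} = u^k = v² = 1, u a u⁻¹ = a^{n₁}, v a v = a^{n₂}, v u v = u⁻¹⟩`. -/
structure Relations {K : Type*} [Group K] (A U V : K) : Prop where
  a_pow : A ^ 2 ^ l = 1
  u_pow : U ^ k = 1
  v_pow : V ^ 2 = 1
  u_a : U * A * U⁻¹ = A ^ (2 ^ (l - 1) + 1)
  v_a : V * A * V = A ^ (2 ^ (l - 1) - 1)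
  v_u : V * U * V = U⁻¹

theorem relations : Relations l k (a l k) (u l k) (v l k) where
  a_pow := by
    rw [a, ← map_pow, ← ofAdd_nsmul]
    simp
  u_pow := by
    rw [u, ← map_pow]
    simp
  v_pow := by
    rw [v, ← map_pow, pow_two]
    simp
  u_a := by
    rw [a, u, ← map_inv, ← SemidirectProduct.inl_aut, ← map_pow, ← ofAdd_nsmul]
    congr 1
    change Multiplicative.ofAdd ((((n1 l) ^ (1 : ZMod k).val : (ZMod (2 ^ l))ˣ) :
      ZMod (2 ^ l)) * 1) = _
    have h1 : (1 : ZMod k).val = 1 := by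
      have : Fact (1 < k) := ⟨one_lt k⟩
      exact ZMod.val_one k
    rw [h1, pow_one, mul_one, nsmul_eq_mul, mul_one]
    rfl
  v_a := by
    have hv : v l k = (v l k)⁻¹ := by
      rw [v, ← map_inv]
      simp
    conv_lhs => rw [mul_assoc]; arg 2; rw [hv]
    rw [← mul_assoc, a, v, ← map_inv, ← SemidirectProduct.inl_aut, ← map_pow, ← ofAdd_nsmul]
    congr 1
    change Multiplicative.ofAdd (((n2 l * (n1 l) ^ (0 : ZMod k).val : (ZMod (2 ^ l))ˣ) :
      ZMod (2 ^ l)) * 1) = _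
    rw [ZMod.val_zero, pow_zero, mul_one, mul_one, nsmul_eq_mul, mul_one]
    rfl
  v_u := by
    rw [u, v, ← map_mul, ← map_mul, ← map_inv]
    simp

section Universal

variable {l k} {K : Type*} [Group K] {A U V : K}

theorem Relations.u_conj (h : Relations l k A U V) (n : ℕ) :
    U * A ^ n = A ^ ((2 ^ (l - 1) + 1) * n) * U := by
  rw [pow_mul, ← h.u_a, conj_pow]
  group

theorem Relations.pow_val_mul (h : Relations l k A U V) (c : ℕ) (x : ZMod (2 ^ l)) :
    A ^ ((c : ZMod (2 ^ l)) * x).val = A ^ (c * x.val) := by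
  rw [ZMod.val_mul, ZMod.val_natCast, ← pow_eq_pow_mod _ h.a_pow, pow_mul, pow_mul,
    ← pow_eq_pow_mod _ h.a_pow]

theorem Relations.u_pow_conj (h : Relations l k A U V) (n : ℕ) (x : ZMod (2 ^ l)) :
    U ^ n * A ^ x.val = A ^ (((n1 l ^ n : (ZMod (2 ^ l))ˣ) : ZMod (2 ^ l)) * x).val * U ^ n := by
  induction n generalizing x with
  | zero => simp
  | succ n ih =>
    rw [pow_succ, mul_assoc, h.u_conj, ← h.pow_val_mul, ← mul_assoc, ih, mul_assoc]
    congr 3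
    rw [pow_succ, Units.val_mul, mul_assoc]
    rfl

theorem Relations.v_conj (h : Relations l k A U V) (x : ZMod (2 ^ l)) :
    V * A ^ x.val = A ^ (((n2 l : (ZMod (2 ^ l))ˣ) : ZMod (2 ^ l)) * x).val * V := by
  have hV : V⁻¹ = V := inv_eq_of_mul_eq_one_left (by rw [← pow_two, h.v_pow])
  have h1 := h.pow_val_mul (2 ^ (l - 1) - 1) x
  change A ^ (((n2 l : (ZMod (2 ^ l))ˣ) : ZMod (2 ^ l)) * x).val = _ at h1
  rw [h1, pow_mul, ← h.v_a]
  have h2 : V * A * V = V * A * V⁻¹ := by rw [hV]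
  rw [h2, conj_pow]
  group

/-- The homomorphism from `ℤ/2^l` sending the generator to `A`. -/
def Relations.homA (h : Relations l k A U V) : Multiplicative (ZMod (2 ^ l)) →* K where
  toFun x := A ^ x.toAdd.val
  map_one' := by simp
  map_mul' x y := by
    rw [toAdd_mul, ZMod.val_add, ← pow_eq_pow_mod _ h.a_pow, pow_add]

theorem Relations.u_pow_add (h : Relations l k A U V) (i j : ZMod k) :
    U ^ (i + j).val = U ^ i.val * U ^ j.val := by
  rw [ZMod.val_add, ← pow_eq_pow_mod _ h.u_pow, pow_add]

theorem Relations.u_pow_neg (h : Relations l k A U V) (i : ZMod k) :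
    U ^ (-i).val = (U ^ i.val)⁻¹ := by
  refine eq_inv_of_mul_eq_one_left ?_
  rw [← h.u_pow_add]
  simp

theorem Relations.u_pow_v (h : Relations l k A U V) (i : ZMod k) :
    U ^ i.val * V = V * U ^ (-i).val := by
  have hV : V⁻¹ = V := inv_eq_of_mul_eq_one_left (by rw [← pow_two, h.v_pow])
  have h2 : V * U * V⁻¹ = U⁻¹ := by rw [hV, h.v_u]
  rw [h.u_pow_neg, ← inv_pow, ← h2, conj_pow]
  conv_rhs => rw [← mul_assoc, ← mul_assoc, ← pow_two, h.v_pow, one_mul, hV]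

/-- The homomorphism from `D_k` sending the generators to `U` and `V`. -/
def Relations.homD (h : Relations l k A U V) : DihedralGroup k →* K where
  toFun
    | .r i => U ^ i.val
    | .sr i => V * U ^ i.val
  map_one' := by
    change U ^ (0 : ZMod k).val = 1
    simp
  map_mul' := by
    rintro (i | i) (j | j)
    · exact h.u_pow_add i j
    · change V * U ^ (j - i).val = U ^ i.val * (V * U ^ j.val)
      rw [← mul_assoc, h.u_pow_v, mul_assoc, ← h.u_pow_add, neg_add_eq_sub]
    · change V * U ^ (i + j).val = (V * U ^ i.val) * U ^ j.val
      rw [h.u_pow_add, mul_assoc]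
    · change U ^ (j - i).val = (V * U ^ i.val) * (V * U ^ j.val)
      rw [mul_assoc, ← mul_assoc (U ^ i.val), h.u_pow_v, ← mul_assoc, ← mul_assoc, ← pow_two,
        h.v_pow, one_mul, ← h.u_pow_add, neg_add_eq_sub]

theorem one_val : (1 : ZMod k).val = 1 := by
  have : Fact (1 < k) := ⟨one_lt k⟩
  exact ZMod.val_one k

theorem two_pow_one_val : (1 : ZMod (2 ^ l)).val = 1 := by
  have : Fact (1 < 2 ^ l) :=
    ⟨Nat.one_lt_two_pow (by have : 3 ≤ l := Fact.out; omega)⟩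
  exact ZMod.val_one _

/-- The semidirect product has the universal property of the presented group. -/
theorem existsUnique_hom (h : Relations l k A U V) :
    ∃! f : ZD l k →* K, f (a l k) = A ∧ f (u l k) = U ∧ f (v l k) = V := by
  refine ⟨SemidirectProduct.lift h.homA h.homD ?_, ⟨?_, ?_, ?_⟩, ?_⟩
  · intro d
    refine MonoidHom.ext fun x => ?_
    change A ^ (((dihedralUnit l k d : (ZMod (2 ^ l))ˣ) : ZMod (2 ^ l)) * x.toAdd).val =
      h.homD d * A ^ x.toAdd.val * (h.homD d)⁻¹
    rw [eq_mul_inv_iff_mul_eq]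
    obtain i | i := d
    · exact (h.u_pow_conj _ _).symm
    · change _ * (V * U ^ i.val) = (V * U ^ i.val) * A ^ x.toAdd.val
      rw [mul_assoc V, h.u_pow_conj, ← mul_assoc V, h.v_conj, mul_assoc, ← mul_assoc (n2 l : ZMod (2 ^ l)),
        ← Units.val_mul]
      rfl
  · rw [a, SemidirectProduct.lift_inl]
    change A ^ (1 : ZMod (2 ^ l)).val = A
    rw [two_pow_one_val, pow_one]
  · rw [u, SemidirectProduct.lift_inr]
    change U ^ (1 : ZMod k).val = U
    rw [one_val, pow_one]
  · rw [v, SemidirectProduct.lift_inr]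
    change V * U ^ (0 : ZMod k).val = V
    simp
  · rintro f ⟨hA, hU, hV⟩
    refine SemidirectProduct.hom_ext ?_ ?_
    · refine MonoidHom.ext fun x => ?_
      simp only [MonoidHom.comp_apply, SemidirectProduct.lift_inl]
      rw [inl_eq, map_pow, hA]
      rfl
    · refine MonoidHom.ext fun d => ?_
      simp only [MonoidHom.comp_apply, SemidirectProduct.lift_inr]
      obtain i | i := d
      · rw [inr_r_eq, map_pow, hU]
        rfl
      · rw [inr_sr_eq, map_mul, map_pow, hU, hV]
        rfl

end Universal

/-! ### The subgroup `⟨a, u²⟩` and its linear characters -/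

/-- The subgroup `⟨a, u²⟩`. -/
def H1 : Subgroup (ZD l k) := Subgroup.closure {a l k, u l k ^ 2}

/-- The projection `a^x u^y v^z ↦ u^y v^z`. -/
def projD : ZD l k →* ZD l k := SemidirectProduct.inr.comp SemidirectProduct.rightHom

theorem projD_mem (h : ZD l k) (hh : h ∈ H1 l k) :
    projD l k h ∈ Subgroup.zpowers (u l k ^ 2) := by
  have : H1 l k ≤ (Subgroup.zpowers (u l k ^ 2)).comap (projD l k) := by
    rw [H1, Subgroup.closure_le]
    rintro x (rfl | rfl)
    · simp [projD, a]
    · have h2 : projD l k (u l k ^ 2) = u l k ^ 2 := by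
        simp only [projD, u, MonoidHom.comp_apply, map_pow, SemidirectProduct.rightHom_inr]
      simp [h2]
  exact this hh

theorem mul_projD_inv_mem (h : ZD l k) : h * (projD l k h)⁻¹ ∈ Subgroup.zpowers (a l k) := by
  have h1 : h * (projD l k h)⁻¹ = SemidirectProduct.inl h.left := by
    rw [projD, MonoidHom.comp_apply, SemidirectProduct.rightHom_eq_right, mul_inv_eq_iff_eq_mul,
      SemidirectProduct.inl_left_mul_inr_right]
  rw [h1, inl_eq]
  exact Subgroup.npow_mem_zpowers _ _

theorem a_u_sq_commute : Commute (a l k) (u l k ^ 2) := by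
  have h := relations l k
  have h0 := h.u_pow_conj 2 (1 : ZMod (2 ^ l))
  rw [two_pow_one_val, pow_one, mul_one, pow_two (n1 l), n1_sq, Units.val_one, two_pow_one_val,
    pow_one] at h0
  exact h0.symm

/-- The component in `⟨u²⟩` of an element of `⟨a, u²⟩ = ⟨a⟩ × ⟨u²⟩`. -/
def partU : H1 l k →* Subgroup.zpowers (u l k ^ 2) :=
  ((projD l k).comp (H1 l k).subtype).codRestrict _ fun h => projD_mem l k h h.2

/-- The component in `⟨a⟩` of an element of `⟨a, u²⟩ = ⟨a⟩ × ⟨u²⟩`. -/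
def partA : H1 l k →* Subgroup.zpowers (a l k) where
  toFun h := ⟨h * (projD l k h)⁻¹, mul_projD_inv_mem l k h⟩
  map_one' := by
    apply Subtype.ext
    simp
  map_mul' g h := by
    apply Subtype.ext
    have hc : Commute ((h : ZD l k) * (projD l k h)⁻¹) (projD l k g)⁻¹ := by
      obtain ⟨m, hm⟩ := mul_projD_inv_mem l k h
      obtain ⟨n, hn⟩ := projD_mem l k g g.2
      simp only at hm hn
      rw [← hm, ← hn]
      exact ((a_u_sq_commute l k).zpow_zpow m n).inv_right
    simp only [Subgroup.coe_mul, map_mul, mul_inv_rev]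
    calc (g : ZD l k) * h * ((projD l k h)⁻¹ * (projD l k g)⁻¹)
        = g * ((h * (projD l k h)⁻¹) * (projD l k g)⁻¹) := by group
      _ = g * ((projD l k g)⁻¹ * (h * (projD l k h)⁻¹)) := by rw [hc.eq]
      _ = _ := by group

theorem partA_mul_partU (h : H1 l k) : (partA l k h : ZD l k) * partU l k h = h :=
  inv_mul_cancel_right _ _

variable {l k}

/-- The linear character `φ_{s,t} = α^s ⊗ β^t` of `⟨a, u²⟩ = ⟨a⟩ × ⟨u²⟩`, for linear characters
`α` of `⟨a⟩` and `β` of `⟨u²⟩`. -/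
def phi (α : Subgroup.zpowers (a l k) →* ℂˣ) (β : Subgroup.zpowers (u l k ^ 2) →* ℂˣ) (s t : ℤ) :
    H1 l k →* ℂˣ :=
  α.comp (partA l k) ^ s * β.comp (partU l k) ^ t

theorem phi_apply (α : Subgroup.zpowers (a l k) →* ℂˣ) (β : Subgroup.zpowers (u l k ^ 2) →* ℂˣ)
    (s t : ℤ) (h : H1 l k) : phi α β s t h = α (partA l k h) ^ s * β (partU l k h) ^ t := rfl

theorem centralizer_eq {r : ℤ} (hr : Odd r) (i : ℤ) :
    Subgroup.centralizer {a l k ^ r * u l k ^ (2 * i)} = H1 l k := by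
  have hc := a_u_sq_commute l k
  have hau : ∀ n : ℤ, Commute (a l k) (u l k ^ (2 * n)) := fun n => by
    rw [zpow_mul]
    exact hc.zpow_right n
  apply le_antisymm
  · intro h hh
    rw [Subgroup.mem_centralizer_singleton_iff] at hh
    obtain ⟨j, hj⟩ := Nat.exists_eq_add_of_le (Fact.out : 3 ≤ l)
    have h4 : (4 : ℕ) ∣ 2 ^ l := by
      rw [hj, pow_add]
      exact Dvd.dvd.mul_right (by norm_num) _
    -- the right components of `a` and `u^{2i}`, and the action of `u^{2i}`
    have hg : a l k ^ r * u l k ^ (2 * i) =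
        ⟨Multiplicative.ofAdd (r : ZMod (2 ^ l)), DihedralGroup.r ((2 * i : ℤ) : ZMod k)⟩ := by
      have h1 : (Multiplicative.ofAdd (1 : ZMod (2 ^ l))) ^ r =
          Multiplicative.ofAdd (r : ZMod (2 ^ l)) := by
        rw [← ofAdd_zsmul, zsmul_eq_mul, mul_one]
      rw [SemidirectProduct.mk_eq_inl_mul_inr, ← h1, ← DihedralGroup.r_one_zpow, map_zpow,
        map_zpow]
      rfl
    have hdu : dihedralUnit l k (DihedralGroup.r ((2 * i : ℤ) : ZMod k)) = 1 := by
      rw [← DihedralGroup.r_one_zpow, map_zpow, zpow_mul]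
      have : dihedralUnit l k (DihedralGroup.r 1) ^ (2 : ℤ) = 1 := by
        change (n1 l ^ (1 : ZMod k).val) ^ (2 : ℤ) = 1
        rw [one_val, pow_one, zpow_two, n1_sq]
      rw [this, one_zpow]
    have hl := congrArg (fun x : ZD l k => x.left.toAdd) hh
    rw [hg] at hl
    change h.left.toAdd + ((dihedralUnit l k h.right : (ZMod (2 ^ l))ˣ) : ZMod (2 ^ l)) *
        (r : ZMod (2 ^ l)) = (r : ZMod (2 ^ l)) +
        ((dihedralUnit l k (DihedralGroup.r ((2 * i : ℤ) : ZMod k)) : (ZMod (2 ^ l))ˣ) :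
          ZMod (2 ^ l)) * h.left.toAdd at hl
    rw [hdu, Units.val_one, one_mul, add_comm] at hl
    have hl2 := add_right_cancel hl
    have hru : IsUnit (r : ZMod (2 ^ l)) := by
      rw [ZMod.coe_int_isUnit_iff_isCoprime]
      push_cast
      exact (Int.isCoprime_iff_gcd_eq_one.mpr
        (by rw [Int.gcd_comm]; exact_mod_cast Int.isCoprime_iff_gcd_eq_one.mp
              (Int.isCoprime_two_right.mpr hr))).pow_left
    have hd1 : dihedralUnit l k h.right = 1 := by
      apply Units.ext
      exact hru.mul_right_cancel (by rw [hl2, Units.val_one, one_mul])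
    have h41 : (4 : ℕ) ∣ 2 ^ (l - 1) := by
      rw [hj, show 3 + j - 1 = 2 + j by omega, pow_add]
      exact Dvd.dvd.mul_right (by norm_num) _
    have h42 : ((2 ^ (l - 1) : ℕ) : ZMod 4) = 0 := (ZMod.natCast_eq_zero_iff _ _).mpr h41
    have hmk := SemidirectProduct.inl_left_mul_inr_right h
    rcases hright : h.right with y | y
    · rw [hright] at hd1 hmk
      change n1 l ^ y.val = 1 at hd1
      have hy : Even y.val := by
        by_contra hy
        obtain ⟨c, hc'⟩ := Nat.not_even_iff_odd.mp hy
        rw [hc', pow_succ, pow_mul, pow_two, n1_sq, one_pow, one_mul] at hd1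
        have h1 := congrArg (fun x : (ZMod (2 ^ l))ˣ => (x : ZMod (2 ^ l))) hd1
        change ((2 ^ (l - 1) + 1 : ℕ) : ZMod (2 ^ l)) = 1 at h1
        rw [Nat.cast_add, Nat.cast_one, add_eq_right, ZMod.natCast_eq_zero_iff,
          Nat.pow_dvd_pow_iff_le_right (by norm_num)] at h1
        omega
      obtain ⟨c, hc'⟩ := hy
      rw [← hmk, inl_eq, inr_r_eq, hc', ← two_mul, pow_mul]
      exact mul_mem (pow_mem (Subgroup.subset_closure (by simp)) _)
        (pow_mem (Subgroup.subset_closure (by simp)) _)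
    · exfalso
      rw [hright] at hd1
      change n2 l * n1 l ^ y.val = 1 at hd1
      have h1 := congrArg (fun x : (ZMod (2 ^ l))ˣ =>
        ZMod.castHom h4 (ZMod 4) (x : ZMod (2 ^ l))) hd1
      simp only [Units.val_mul, Units.val_pow_eq_pow_val, map_mul, map_pow, Units.val_one,
        map_one] at h1
      change ZMod.castHom h4 (ZMod 4) ((2 ^ (l - 1) - 1 : ℕ) : ZMod (2 ^ l)) *
        (ZMod.castHom h4 (ZMod 4) ((2 ^ (l - 1) + 1 : ℕ) : ZMod (2 ^ l))) ^ y.val = 1 at h1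
      rw [map_natCast, map_natCast, Nat.cast_sub Nat.one_le_two_pow, Nat.cast_add, h42] at h1
      simp at h1
      exact absurd h1 (by decide)
  · rw [H1, Subgroup.closure_le]
    rintro x (rfl | rfl)
    · rw [SetLike.mem_coe, Subgroup.mem_centralizer_singleton_iff]
      exact (((Commute.refl (a l k)).zpow_right r).mul_right (hau i)).eq
    · rw [SetLike.mem_coe, Subgroup.mem_centralizer_singleton_iff]
      refine ((hc.symm.zpow_right r).mul_right ?_).eq
      exact ((Commute.refl (u l k)).pow_left 2).zpow_right _

/-- The character `φ_{s,t}` on the centralizer of `a^r u^{2i}` (`r` odd), which is `⟨a, u²⟩`. -/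
def centralizerPhi (α : Subgroup.zpowers (a l k) →* ℂˣ)
    (β : Subgroup.zpowers (u l k ^ 2) →* ℂˣ) {r : ℤ} (hr : Odd r) (i s t : ℤ) :
    Subgroup.centralizer {a l k ^ r * u l k ^ (2 * i)} →* ℂˣ :=
  (phi α β s t).comp (MulEquiv.subgroupCongr (centralizer_eq hr i)).toMonoidHom

/-- The module `M(class(a^r u^{2i}), φ_{s,t})` with `r` odd. -/
abbrev OddTypeIModule (α : Subgroup.zpowers (a l k) →* ℂˣ)
    (β : Subgroup.zpowers (u l k ^ 2) →* ℂˣ) {r : ℤ} (hr : Odd r) (i s t : ℤ) : Type :=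
  DoubleModule (a l k ^ r * u l k ^ (2 * i)) (charRep (centralizerPhi α β hr i s t))

end ZD

end Group

end DoubleIndicator

end

/-! The iterated coproduct of `p_g ⋈ h` multiplies out to the sum of the `p_x ⋈ h^m` over those `x`
with `h^{-m}(hx)^m = g`. Applied to `Λ = |G|⁻¹ ∑ p_1 ⋈ h`, and paired with the character of
`M(class(s), χ)`, this gives (`DoubleModule.indicator_eq`) `ν_m = |C(s)|⁻¹ ∑ χ(h^m)`, summed over
the `h` in `G` with `(hs)^m = h^m`.

Now let `s = a^r u^{2i}` with `r` odd, let `h` have component `d` in `D_k`, and let `w` be the unit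
by which `d` acts on `ℤ/2^l`. Since `u²` acts trivially and `r` is a unit, `(hs)^m = h^m` means that
`∑_{j<m} w^j = 0` and that the `D_k` components agree (`ZD.mul_pow_eq_pow_iff`). Then `h^m` is
`d^m`, so everything depends on `d` alone and `k ν_m = 2 ∑_d (term of d)` (`ZD.k_mul_indicator`).

For odd `m` the geometric sum is odd, so `ν_m = 0`. For `m = 2n` one has `w² = 1`, and the sum is
`n(1 + w)`: - rotations, `w = 1` or `n₁`: it vanishes iff `2^l ∣ m`. The `D_k` condition is `k ∣
2mi`, and summing the character over all rotations gives `k` or `0` according to whether `k ∣ mt`.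
Contribution to `ν_m`: `2` or `0`. - reflections `v u^y` with `y` even, `w = n₂`: it vanishes iff `4
∣ m`. Contribution: `1` or `0`. - reflections `v u^y` with `y` odd, `w = -1`: it always vanishes.
Contribution: `1`.

Adding these gives the table. For the module itself, the dimension is the index `4` of the
centralizer, and simplicity holds for every linear character. -/

noncomputable section

namespace DoubleIndicator

/-! ### Sweedler powers in the double of a finite group. -/

namespace DrinfeldDouble

variable {G : Type*} [Group G] [DecidableEq G] [Fintype G]

/-- A product `(p_{x₁} ⋈ h) ⋯ (p_{x_m} ⋈ h)` is nonzero only if `x_{j+1} = h⁻¹ x_j h`, so it is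
determined by `x = x₁`. The co-opposite coproduct requires `x_m ⋯ x₁ = g`, and this product
telescopes to `h^{-m}(hx)^m`. -/
theorem sweedlerPower_e (m : ℕ) (g h : G) :
    sweedlerPower m (e g h : DrinfeldDouble G) =
      ∑ x : G, if (h ^ m)⁻¹ * (h * x) ^ m = g then e x (h ^ m) else 0 := by
  induction m generalizing g with
  | zero =>
    simp only [sweedlerPower, pow_zero, LinearMap.convOne_apply, counit_e, inv_one, mul_one]
    by_cases hg : g = 1
    · subst hg
      simp [one_def]
    · simp [hg, Ne.symm hg]
  | succ m ih =>
    simp only [sweedlerPower] at ih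
    simp only [sweedlerPower, pow_succ _ m, LinearMap.convMul_apply, comul_e, map_sum,
      TensorProduct.map_tmul, LinearMap.mul'_apply]
    erw [Finset.sum_congr rfl fun y _ => congrArg (· * e y h) (ih (y⁻¹ * g))]
    simp only [Finset.sum_mul, ite_mul, zero_mul, e_mul_e]
    rw [Finset.sum_comm]
    refine Finset.sum_congr rfl fun x _ => ?_
    -- The only `y` for which `(p_x ⋈ h^m)(p_y ⋈ h)` is nonzero.
    rw [Finset.sum_eq_single ((h ^ m)⁻¹ * x * h ^ m)]
    · have h1 : x = h ^ m * ((h ^ m)⁻¹ * x * h ^ m) * (h ^ m)⁻¹ := by group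
      rw [if_pos h1]
      refine if_congr ?_ rfl rfl
      rw [eq_inv_mul_iff_mul_eq, ← pow_succ, ← pow_succ]
      refine Eq.congr_left ?_
      rw [pow_succ' (h * x), pow_succ h]
      generalize (h * x) ^ m = z
      group
    · intro y _ hy
      have h1 : x ≠ h ^ m * y * (h ^ m)⁻¹ := by
        rintro rfl
        exact hy (by group)
      rw [if_neg h1, ite_self]
    · simp

theorem sweedlerPower_integral (m : ℕ) :
    sweedlerPower m (integral G) = (Fintype.card G : ℂ)⁻¹ •
      ∑ h : G, ∑ x : G, if (h * x) ^ m = h ^ m then e x (h ^ m) else 0 := by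
  rw [integral_spec.unique isNormalizedIntegral]
  have h0 : ∀ h : G, sweedlerPower m (e 1 h : DrinfeldDouble G) = _ := sweedlerPower_e m 1
  simp only [sweedlerPower] at h0
  simp only [sweedlerPower, map_smul, map_sum, h0]
  simp only [inv_mul_eq_one, eq_comm]

end DrinfeldDouble

/-! ### Simplicity, character and indicators of `M(class(s), χ)` for a linear character `χ`. -/

section LinearCharacter

variable {G : Type*} [Group G] {s : G} (χ : Subgroup.centralizer {s} →* ℂˣ)

open Classical in
/-- The extension by zero of a linear character of a centralizer to the group. -/
def extendByZero (g : G) : ℂ :=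
  if h : g ∈ Subgroup.centralizer {s} then χ ⟨g, h⟩ else 0

theorem extendByZero_of_mem {g : G} (h : g ∈ Subgroup.centralizer {s}) :
    extendByZero χ g = χ ⟨g, h⟩ := dif_pos h

namespace DoubleModule

/-- The basis `g_q ⊗ 1` of `M(class(s), χ)` for a linear character `χ`. -/
def basis : Module.Basis (G ⧸ Subgroup.centralizer {s}) ℂ (DoubleModule s (charRep χ)) :=
  (Finsupp.basisSingleOne :
    Module.Basis (G ⧸ Subgroup.centralizer {s}) ℂ ((G ⧸ Subgroup.centralizer {s}) →₀ ℂ))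

theorem basis_apply (q : G ⧸ Subgroup.centralizer {s}) :
    basis χ q = of s (charRep χ) q 1 := by
  exact Finsupp.coe_basisSingleOne (R := ℂ) ▸ rfl

theorem of_eq_smul_basis (q : G ⧸ Subgroup.centralizer {s}) (w : ℂ) :
    of s (charRep χ) q w = w • basis χ q := by
  rw [basis_apply, ← map_smul, smul_eq_mul, mul_one]

theorem finrank_eq : Module.finrank ℂ (DoubleModule s (charRep χ)) =
    (Subgroup.centralizer {s}).index :=
  Module.finrank_eq_nat_card_basis (basis χ)

theorem cosetConj_injective (s : G) : Function.Injective (cosetConj s) := by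
  intro q q' h
  rw [← QuotientGroup.out_eq' q, ← QuotientGroup.out_eq' q']
  refine QuotientGroup.eq.mpr (Subgroup.mem_centralizer_singleton_iff.mpr ?_)
  simp only [cosetConj] at h
  have h2 : s * (q.out⁻¹ * q'.out) = q.out⁻¹ * (q.out * s * q.out⁻¹) * q'.out := by group
  rw [h2, h]
  group

variable [DecidableEq G] [Fintype G]

theorem e_smul_basis (g h : G) (q : G ⧸ Subgroup.centralizer {s}) :
    (DrinfeldDouble.e g h : DrinfeldDouble G) • basis χ q =
      if cosetConj s (h • q) = g then (χ (cosetCocycle s h q) : ℂ) • basis χ (h • q) else 0 := by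
  rw [basis_apply, e_smul_of, charRep_apply, mul_one, of_eq_smul_basis]

/-- The degrees `t_q` are distinct, so `p_{t_q}` cuts a nonzero vector of a submodule down to a
nonzero multiple of one basis vector. Since `G` permutes the cosets transitively, up to nonzero
scalars, all basis vectors follow. -/
theorem isSimpleModule : IsSimpleModule (DrinfeldDouble G) (DoubleModule s (charRep χ)) := by
  have key : ∀ N : Submodule (DrinfeldDouble G) (DoubleModule s (charRep χ)), ∀ v ∈ N, v ≠ 0 →
      N = ⊤ := by
    intro N v hv hv0
    have hsmul : ∀ (c : ℂ) (w), w ∈ N → c • w ∈ N := fun c w hw => by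
      have := N.smul_mem (c • (1 : DrinfeldDouble G)) hw
      rwa [smul_assoc, one_smul] at this
    obtain ⟨q, hq⟩ : ∃ q, (basis χ).repr v q ≠ 0 := by
      by_contra! h
      exact hv0 ((basis χ).repr.map_eq_zero_iff.mp (Finsupp.ext h))
    have hproj : (DrinfeldDouble.e (cosetConj s q) 1 : DrinfeldDouble G) • v =
        (basis χ).repr v q • basis χ q := by
      conv_lhs => rw [← (basis χ).linearCombination_repr v, Finsupp.linearCombination_apply,
        Finsupp.sum, Finset.smul_sum]
      rw [Finset.sum_eq_single q]
      · rw [smul_comm, e_smul_basis, one_smul, if_pos rfl, cosetCocycle_one, map_one,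
          Units.val_one, one_smul]
      · intro q' _ hq'
        rw [smul_comm, e_smul_basis, one_smul, if_neg (fun h => hq' (cosetConj_injective s h)),
          smul_zero]
      · intro h
        rw [Finsupp.notMem_support_iff.mp h, zero_smul, smul_zero]
    have hb : basis χ q ∈ N := by
      have h1 := hsmul ((basis χ).repr v q)⁻¹ _ (hproj ▸ N.smul_mem _ hv)
      rwa [smul_smul, inv_mul_cancel₀ hq, one_smul] at h1
    have hb' : ∀ q', basis χ q' ∈ N := fun q' => by
      obtain ⟨g, rfl⟩ := MulAction.exists_smul_eq G q q'
      have h1 := N.smul_mem (DrinfeldDouble.e (cosetConj s (g • q)) g) hb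
      rw [e_smul_basis, if_pos rfl] at h1
      have h2 := hsmul (χ (cosetCocycle s g q) : ℂ)⁻¹ _ h1
      rwa [smul_smul, inv_mul_cancel₀ (Units.ne_zero _), one_smul] at h2
    refine Submodule.eq_top_iff'.mpr fun w => ?_
    rw [← (basis χ).linearCombination_repr w, Finsupp.linearCombination_apply]
    exact N.sum_mem fun q' _ => hsmul _ _ (hb' q')
  have : Nontrivial (DoubleModule s (charRep χ)) :=
    ⟨basis χ (1 : G), 0, (basis χ).ne_zero _⟩
  rw [isSimpleModule_iff]
  refine { eq_bot_or_eq_top := fun N => ?_ }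
  by_cases h : N = ⊥
  · exact Or.inl h
  · obtain ⟨v, hv, hv0⟩ := N.ne_bot_iff.mp h
    exact Or.inr (key N v hv hv0)

/-- Only cosets with `hq = q` meet the diagonal. This is the condition that `g_q⁻¹ h g_q`
centralizes `s`, and that element is then the cocycle; extending `χ` by zero absorbs the condition.
-/
theorem character_e [Fintype (G ⧸ Subgroup.centralizer {s})] (g h : G) :
    character (DoubleModule s (charRep χ)) (DrinfeldDouble.e g h : DrinfeldDouble G) =
      ∑ q : G ⧸ Subgroup.centralizer {s},
        if cosetConj s q = g then extendByZero χ (q.out⁻¹ * h * q.out) else 0 := by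
  classical
  rw [character, LinearMap.trace_eq_matrix_trace ℂ (basis χ), Matrix.trace]
  refine Finset.sum_congr rfl fun q _ => ?_
  rw [Matrix.diag_apply, LinearMap.toMatrix_apply]
  change (basis χ).repr ((DrinfeldDouble.e g h : DrinfeldDouble G) • basis χ q) q = _
  rw [e_smul_basis]
  have hmem : q.out⁻¹ * h * q.out ∈ Subgroup.centralizer {s} ↔ h • q = q := by
    rw [mul_assoc, ← QuotientGroup.eq, QuotientGroup.out_eq', eq_comm]
    conv_rhs => lhs; rw [← QuotientGroup.out_eq' q]
    rfl
  by_cases hq : h • q = q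
  · rw [extendByZero_of_mem χ (hmem.mpr hq)]
    have h1 : cosetCocycle s h q = ⟨q.out⁻¹ * h * q.out, hmem.mpr hq⟩ := by
      apply Subtype.ext
      simp only [cosetCocycle]
      rw [hq, mul_assoc]
    rw [h1]
    simp only [hq]
    split_ifs <;> simp
  · rw [extendByZero, dif_neg (fun h => hq (hmem.mp h)), ite_self]
    split_ifs <;> simp [hq]

/-- Each of the `[G : C(s)]` cosets contributes the same sum, which turns `|G|⁻¹` into `|C(s)|⁻¹`.
If `(hs)^m = h^m`, then `h^m` commutes with `h` and `hs`, hence with `s`, so the zero values of the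
extension never enter. -/
theorem indicator_eq (m : ℕ) :
    DrinfeldDouble.indicator G (DoubleModule s (charRep χ)) m =
      (Nat.card (Subgroup.centralizer {s}) : ℂ)⁻¹ *
        ∑ h : G, if (h * s) ^ m = h ^ m then extendByZero χ (h ^ m) else 0 := by
  classical
  let _ : Fintype (G ⧸ Subgroup.centralizer {s}) := Fintype.ofFinite _
  rw [DrinfeldDouble.indicator, DrinfeldDouble.sweedlerPower_integral]
  have hlin : ∀ x, character (DoubleModule s (charRep χ)) x =
    ((LinearMap.trace ℂ _).comp (Algebra.lsmul ℂ ℂ (DoubleModule s (charRep χ))).toLinearMap :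
      DrinfeldDouble G →ₗ[ℂ] ℂ) x := fun x => rfl
  have he := fun g h : G => character_e χ g h
  simp only [hlin] at he
  simp only [hlin, map_smul, map_sum, apply_ite (_ : DrinfeldDouble G →ₗ[ℂ] ℂ), map_zero, he]
  -- For each coset `q` only `x = t_q` survives.
  have hsum : ∀ h : G, (∑ x : G, if (h * x) ^ m = h ^ m then
        (∑ q : G ⧸ Subgroup.centralizer {s},
          if cosetConj s q = x then extendByZero χ (q.out⁻¹ * h ^ m * q.out) else 0) else 0) =
      ∑ q : G ⧸ Subgroup.centralizer {s}, if (h * cosetConj s q) ^ m = h ^ m then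
        extendByZero χ (q.out⁻¹ * h ^ m * q.out) else 0 := by
    intro h
    have h1 : ∀ x : G, (if (h * x) ^ m = h ^ m then (∑ q : G ⧸ Subgroup.centralizer {s},
          if cosetConj s q = x then extendByZero χ (q.out⁻¹ * h ^ m * q.out) else 0) else 0) =
        ∑ q : G ⧸ Subgroup.centralizer {s}, if cosetConj s q = x then
          (if (h * cosetConj s q) ^ m = h ^ m then
            extendByZero χ (q.out⁻¹ * h ^ m * q.out) else 0) else 0 := by
      intro x
      by_cases hx : (h * x) ^ m = h ^ m
      · rw [if_pos hx]
        refine Finset.sum_congr rfl fun q _ => ?_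
        by_cases hq : cosetConj s q = x
        · rw [if_pos hq, if_pos hq, if_pos (hq ▸ hx)]
        · rw [if_neg hq, if_neg hq]
      · rw [if_neg hx]
        refine (Finset.sum_eq_zero fun q _ => ?_).symm
        by_cases hq : cosetConj s q = x
        · rw [if_pos hq, if_neg (hq ▸ hx)]
        · rw [if_neg hq]
    simp only [h1]
    rw [Finset.sum_comm]
    simp only [Finset.sum_ite_eq, Finset.mem_univ, if_true]
  simp only [hsum]
  rw [Finset.sum_comm]
  -- Substituting `g_q h g_q⁻¹` for `h` turns `t_q` into `s` and removes the dependence on `q`.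
  have hconj : ∀ q : G ⧸ Subgroup.centralizer {s},
      (∑ h : G, if (h * cosetConj s q) ^ m = h ^ m then
        extendByZero χ (q.out⁻¹ * h ^ m * q.out) else 0) =
      ∑ h : G, if (h * s) ^ m = h ^ m then extendByZero χ (h ^ m) else 0 := by
    intro q
    symm
    refine Fintype.sum_equiv (MulAut.conj q.out).toEquiv _ _ fun h => ?_
    have h1 : MulAut.conj q.out h * cosetConj s q = MulAut.conj q.out (h * s) := by
      simp [cosetConj, mul_assoc]
    simp only [MulEquiv.toEquiv_eq_coe, EquivLike.coe_coe]
    rw [h1, ← map_pow, ← map_pow]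
    simp only [(MulAut.conj q.out).injective.eq_iff]
    simp [mul_assoc]
  simp only [hconj, Finset.sum_const, Finset.card_univ, nsmul_eq_mul, smul_eq_mul]
  rw [← mul_assoc]
  congr 1
  have hcard := Subgroup.card_eq_card_quotient_mul_card_subgroup (Subgroup.centralizer {s})
  rw [Nat.card_eq_fintype_card, Nat.card_eq_fintype_card (α := G ⧸ _)] at hcard
  have h0 : (Fintype.card (G ⧸ Subgroup.centralizer {s}) : ℂ) ≠ 0 :=
    Nat.cast_ne_zero.mpr Fintype.card_ne_zero
  rw [hcard, Nat.cast_mul, mul_inv, mul_comm, ← mul_assoc, mul_inv_cancel₀ h0, one_mul]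

end DoubleModule

end LinearCharacter

/-! ### Geometric sums, and characters of cyclic groups. -/

theorem sum_zmod_val {M : Type*} [AddCommMonoid M] (k : ℕ) [NeZero k] (f : ℕ → M) :
    ∑ y : ZMod k, f y.val = ∑ j ∈ Finset.range k, f j := by
  -- With `k = K + 1`, `ZMod k` unfolds to `Fin (K + 1)`.
  obtain ⟨K, rfl⟩ := Nat.exists_eq_succ_of_ne_zero (NeZero.ne k)
  exact Fin.sum_univ_eq_sum_range f (K + 1)

theorem sum_range_two_mul_parity (c : ℕ) (p q : ℂ) :
    ∑ j ∈ Finset.range (2 * c), (if Even j then p else q) = c * (p + q) := by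
  induction c with
  | zero => simp
  | succ c ih =>
    rw [mul_add, Finset.sum_range_succ, Finset.sum_range_succ, ih, if_pos (even_two_mul c),
      if_neg (by simp)]
    push_cast
    ring

theorem geom_sum_two_mul_of_mul_self_eq_one {R : Type*} [CommRing R] {w : R} (hw : w * w = 1)
    (n : ℕ) : ∑ j ∈ Finset.range (2 * n), w ^ j = n * (1 + w) := by
  induction n with
  | zero => simp
  | succ n ih =>
    have h1 : w ^ (2 * n) = 1 := by rw [pow_mul, pow_two, hw, one_pow]
    rw [mul_add, Finset.sum_range_succ, Finset.sum_range_succ, ih, pow_succ, h1]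
    push_cast
    ring

theorem geom_sum_root_of_unity {k : ℕ} {ζ : ℂ} (h : ζ ^ k = 1) :
    ∑ j ∈ Finset.range k, ζ ^ j = if ζ = 1 then (k : ℂ) else 0 := by
  split_ifs with h1
  · simp [h1]
  · rw [geom_sum_eq h1, h, sub_self, zero_div]

/-- A unit modulo `2^l` is `1` modulo `2`, so the sum reduces to `m`, which is odd. -/
theorem geom_sum_unit_ne_zero {l m : ℕ} (hl : l ≠ 0) (hm : Odd m) (w : (ZMod (2 ^ l))ˣ) :
    ∑ j ∈ Finset.range m, (w : ZMod (2 ^ l)) ^ j ≠ 0 := by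
  intro h
  have h1 := congrArg (ZMod.castHom (dvd_pow_self 2 hl) (ZMod 2)) h
  have h2 : ZMod.castHom (dvd_pow_self 2 hl) (ZMod 2) (w : ZMod (2 ^ l)) = 1 := by
    have h3 : IsUnit (ZMod.castHom (dvd_pow_self 2 hl) (ZMod 2) (w : ZMod (2 ^ l))) :=
      w.isUnit.map _
    generalize ZMod.castHom (dvd_pow_self 2 hl) (ZMod 2) (w : ZMod (2 ^ l)) = z at h3
    revert z
    decide
  simp only [map_sum, map_pow, h2, one_pow, Finset.sum_const, Finset.card_range, nsmul_eq_mul,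
    mul_one, map_zero, ZMod.natCast_eq_zero_iff] at h1
  exact Nat.not_even_iff_odd.mpr hm (even_iff_two_dvd.mpr h1)

/-- Complex characters of a finite abelian group separate points, and an element killed by `β` is
killed by all powers of `β`. -/
theorem generator_monoidHom_injective {A : Type*} [Group A] [IsCyclic A] [Finite A]
    {β : A →* ℂˣ} (hβ : ∀ χ : A →* ℂˣ, χ ∈ Subgroup.zpowers β) : Function.Injective β := by
  refine (injective_iff_map_eq_one β).mpr fun x hx => ?_
  by_contra hx1
  let _ : CommGroup A := IsCyclic.commGroup
  obtain ⟨χ, hχ⟩ := CommGroup.exists_apply_ne_one_of_hasEnoughRootsOfUnity A ℂ hx1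
  obtain ⟨n, rfl⟩ := hβ χ
  exact hχ (by simp [hx])

/-! ### Arithmetic of `n₁` and `n₂` modulo `2^l`. -/

namespace ZD

variable {l k : ℕ} [Fact (3 ≤ l)]

theorem exists_eq_add_three (l : ℕ) [h : Fact (3 ≤ l)] : ∃ j, l = j + 3 := by
  obtain ⟨j, hj⟩ := Nat.exists_eq_add_of_le h.out
  exact ⟨j, by omega⟩

theorem n1_pow (y : ℕ) : n1 l ^ y = if Even y then 1 else n1 l := by
  split_ifs with h
  · obtain ⟨c, rfl⟩ := h
    rw [← two_mul, pow_mul, pow_two, n1_sq, one_pow]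
  · obtain ⟨c, rfl⟩ := Nat.not_even_iff_odd.mp h
    rw [pow_succ, pow_mul, pow_two, n1_sq, one_pow, one_mul]

theorem coe_n1 : (n1 l : ZMod (2 ^ l)) = ((2 ^ (l - 1) + 1 : ℕ) : ZMod (2 ^ l)) := rfl

theorem coe_n2 : (n2 l : ZMod (2 ^ l)) = ((2 ^ (l - 1) - 1 : ℕ) : ZMod (2 ^ l)) := rfl

theorem one_add_n2 : 1 + (n2 l : ZMod (2 ^ l)) = ((2 ^ (l - 1) : ℕ) : ZMod (2 ^ l)) := by
  rw [coe_n2, Nat.cast_sub Nat.one_le_two_pow]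
  simp

/-- The product is `(2^{l-1})² - 1`, and `2(l - 1) ≥ l`. -/
theorem n2_mul_n1 : (n2 l : ZMod (2 ^ l)) * n1 l = -1 := by
  have h := one_add_n2 (l := l)
  have h0 : ((2 ^ (l - 1) : ℕ) : ZMod (2 ^ l)) * ((2 ^ (l - 1) : ℕ) : ZMod (2 ^ l)) = 0 := by
    rw [← Nat.cast_mul, ZMod.natCast_eq_zero_iff, ← pow_add]
    exact pow_dvd_pow _ (by obtain ⟨j, rfl⟩ := exists_eq_add_three l; omega)
  rw [eq_sub_of_add_eq' h, coe_n1, Nat.cast_add, Nat.cast_one]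
  linear_combination h0

/-- The sum is `2n` for even `y` and `2n(2^{l-2} + 1)` for odd `y`; the extra factor is odd because
`l ≥ 3`. -/
theorem geom_sum_rotation_eq_zero_iff (n y : ℕ) :
    ∑ j ∈ Finset.range (2 * n), ((n1 l ^ y : (ZMod (2 ^ l))ˣ) : ZMod (2 ^ l)) ^ j = 0 ↔
      2 ^ l ∣ 2 * n := by
  rw [n1_pow, geom_sum_two_mul_of_mul_self_eq_one]
  · split_ifs with h
    · rw [← ZMod.natCast_eq_zero_iff, Units.val_one]
      push_cast
      rw [one_add_one_eq_two, mul_comm]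
    · have hc : (n : ZMod (2 ^ l)) * (1 + (n1 l : ZMod (2 ^ l))) =
          ((2 * n * (2 ^ (l - 2) + 1) : ℕ) : ZMod (2 ^ l)) := by
        rw [coe_n1]
        obtain ⟨j, rfl⟩ := exists_eq_add_three l
        rw [show j + 3 - 1 = j + 1 + 1 by omega, show j + 3 - 2 = j + 1 by omega]
        push_cast
        ring
      rw [hc, ZMod.natCast_eq_zero_iff]
      refine Nat.Coprime.dvd_mul_right (Nat.Coprime.pow_left _ ?_)
      rw [Nat.coprime_two_left]
      obtain ⟨j, rfl⟩ := exists_eq_add_three l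
      rw [show j + 3 - 2 = j + 1 by omega, pow_succ]
      exact Even.add_one (even_two.mul_left _)
  · split_ifs
    · simp
    · exact n1_mul_n1 l

/-- The sum is `n · 2^{l-1}` for even `y`; for odd `y` the unit is `-1` and the sum is `0`. -/
theorem geom_sum_reflection_eq_zero_iff (n y : ℕ) :
    ∑ j ∈ Finset.range (2 * n), ((n2 l * n1 l ^ y : (ZMod (2 ^ l))ˣ) : ZMod (2 ^ l)) ^ j = 0 ↔
      Even y → 2 ∣ n := by
  rw [n1_pow, geom_sum_two_mul_of_mul_self_eq_one]
  · split_ifs with h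
    · obtain ⟨j, hj⟩ := exists_eq_add_three l
      rw [mul_one, one_add_n2, ← Nat.cast_mul, ZMod.natCast_eq_zero_iff]
      simp only [h, true_imp_iff]
      have h1 : 2 ^ l = 2 * 2 ^ (l - 1) := by
        rw [← pow_succ']
        congr 1
        omega
      rw [h1]
      exact Nat.mul_dvd_mul_iff_right (by positivity)
    · rw [Units.val_mul, n2_mul_n1]
      simp [h]
  · split_ifs
    · rw [mul_one]
      exact n2_mul_n2 l
    · rw [Units.val_mul, n2_mul_n1]
      ring

theorem n1_pow_eq_one_iff (y : ℕ) : n1 l ^ y = 1 ↔ Even y := by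
  rw [n1_pow]
  split_ifs with h
  · simp [h]
  · simp only [h, iff_false]
    intro h1
    have h2 := congrArg (fun x : (ZMod (2 ^ l))ˣ => (x : ZMod (2 ^ l))) h1
    obtain ⟨j, hj⟩ := exists_eq_add_three l
    simp only [coe_n1, Units.val_one] at h2
    rw [Nat.cast_add, Nat.cast_one, add_eq_right, ZMod.natCast_eq_zero_iff,
      Nat.pow_dvd_pow_iff_le_right (by norm_num)] at h2
    omega

/-- The geometric sum of length `4` vanishes for this unit, whereas for `1` it is `4`, nonzero
modulo `2^l` as `l ≥ 3`. -/
theorem n2_mul_n1_pow_ne_one (y : ℕ) : n2 l * n1 l ^ y ≠ 1 := by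
  intro h
  have h1 := (geom_sum_reflection_eq_zero_iff (l := l) 2 y).mpr (fun _ => dvd_refl 2)
  rw [h] at h1
  simp only [Units.val_one, one_pow, Finset.sum_const, Finset.card_range, nsmul_eq_mul, mul_one,
    ZMod.natCast_eq_zero_iff] at h1
  obtain ⟨j, rfl⟩ := exists_eq_add_three l
  have h2 : 2 ^ (j + 3) ∣ 2 ^ 2 := h1
  rw [Nat.pow_dvd_pow_iff_le_right (by norm_num)] at h2
  omega

/-! ### Powers and centralizers in the coordinates of `ℤ_{2^l} ⋊ D_k`. -/

variable [Fact (4 ∣ k)] [NeZero k]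

theorem dihedralUnit_r (y : ZMod k) : dihedralUnit l k (.r y) = n1 l ^ y.val := rfl

theorem dihedralUnit_sr (y : ZMod k) : dihedralUnit l k (.sr y) = n2 l * n1 l ^ y.val := rfl

theorem dihedralUnit_r_two_mul (i : ℤ) :
    dihedralUnit l k (DihedralGroup.r ((2 * i : ℤ) : ZMod k)) = 1 := by
  rw [← DihedralGroup.r_one_zpow, map_zpow, zpow_mul]
  have : dihedralUnit l k (DihedralGroup.r 1) ^ (2 : ℤ) = 1 := by
    rw [dihedralUnit_r, one_val, pow_one, zpow_two, n1_sq]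
  rw [this, one_zpow]

theorem a_zpow_mul_u_zpow (x y : ℤ) : a l k ^ x * u l k ^ y =
    ⟨Multiplicative.ofAdd (x : ZMod (2 ^ l)), DihedralGroup.r (y : ZMod k)⟩ := by
  have h1 : (Multiplicative.ofAdd (1 : ZMod (2 ^ l))) ^ x =
      Multiplicative.ofAdd (x : ZMod (2 ^ l)) := by
    rw [← ofAdd_zsmul, zsmul_eq_mul, mul_one]
  rw [SemidirectProduct.mk_eq_inl_mul_inr, ← h1, ← DihedralGroup.r_one_zpow, map_zpow,
    map_zpow]
  rfl

theorem u_zpow_eq_one_iff (y : ℤ) : u l k ^ y = 1 ↔ (k : ℤ) ∣ y := by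
  rw [u, ← map_zpow, map_eq_one_iff _ SemidirectProduct.inr_injective, DihedralGroup.r_one_zpow,
    DihedralGroup.one_def, DihedralGroup.r.injEq, ZMod.intCast_zmod_eq_zero_iff_dvd]

theorem mul_left_toAdd (g h : ZD l k) : (g * h).left.toAdd =
    g.left.toAdd + (dihedralUnit l k g.right : ZMod (2 ^ l)) * h.left.toAdd := rfl

theorem pow_right (h : ZD l k) (m : ℕ) : (h ^ m).right = h.right ^ m :=
  map_pow SemidirectProduct.rightHom h m

theorem pow_left_toAdd (h : ZD l k) (m : ℕ) : (h ^ m).left.toAdd =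
    (∑ j ∈ Finset.range m, (dihedralUnit l k h.right : ZMod (2 ^ l)) ^ j) * h.left.toAdd := by
  induction m with
  | zero => simp
  | succ m ih =>
    rw [pow_succ', mul_left_toAdd, ih, geom_sum_succ]
    ring

theorem isUnit_intCast_of_odd {r : ℤ} (hr : Odd r) : IsUnit (r : ZMod (2 ^ l)) := by
  rw [ZMod.coe_int_isUnit_iff_isCoprime]
  push_cast
  exact (Int.isCoprime_two_right.mpr hr).symm.pow_left

theorem ext_iff' {g h : ZD l k} :
    g = h ↔ g.left.toAdd = h.left.toAdd ∧ g.right = h.right := by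
  rw [SemidirectProduct.ext_iff]
  rfl

/-- Since `u^{2i}` acts trivially, `h` and `hs` act by the same unit `w`, and their first
coordinates differ by `w r`. Those of the `m`-th powers differ by `w r ∑ w^j`, where `w r` is a
unit. -/
theorem mul_pow_eq_pow_iff {r : ℤ} (hr : Odd r) (i : ℤ) (h : ZD l k) (m : ℕ) :
    (h * (a l k ^ r * u l k ^ (2 * i))) ^ m = h ^ m ↔
      ∑ j ∈ Finset.range m, (dihedralUnit l k h.right : ZMod (2 ^ l)) ^ j = 0 ∧
        (h.right * DihedralGroup.r ((2 * i : ℤ) : ZMod k)) ^ m = h.right ^ m := by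
  rw [a_zpow_mul_u_zpow, ext_iff', pow_left_toAdd, pow_left_toAdd, pow_right, pow_right,
    mul_left_toAdd, SemidirectProduct.mul_right, map_mul, dihedralUnit_r_two_mul, mul_one,
    toAdd_ofAdd, mul_add, add_eq_left,
    ((Units.isUnit _).mul (isUnit_intCast_of_odd hr)).mul_left_eq_zero]

/-- Comparing first coordinates forces `w r = r`, hence `w = 1`, which singles out the even
rotations; these commute with `u^{2i}`. This coordinate form is what makes the centralizer easy to
count. -/
theorem mem_centralizer_iff {r : ℤ} (hr : Odd r) (i : ℤ) (h : ZD l k) :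
    h ∈ Subgroup.centralizer {a l k ^ r * u l k ^ (2 * i)} ↔
      ∃ y : ZMod k, Even y.val ∧ h.right = DihedralGroup.r y := by
  rw [Subgroup.mem_centralizer_singleton_iff, a_zpow_mul_u_zpow, ext_iff', mul_left_toAdd,
    mul_left_toAdd, dihedralUnit_r_two_mul, Units.val_one, one_mul, toAdd_ofAdd, add_comm,
    add_left_inj, (isUnit_intCast_of_odd hr).mul_eq_right, Units.val_eq_one,
    SemidirectProduct.mul_right, SemidirectProduct.mul_right]
  constructor
  · rintro ⟨h1, -⟩
    rcases hd : h.right with y | y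
    · rw [hd, dihedralUnit_r, n1_pow_eq_one_iff] at h1
      exact ⟨y, h1, rfl⟩
    · rw [hd, dihedralUnit_sr] at h1
      exact absurd h1 (n2_mul_n1_pow_ne_one _)
  · rintro ⟨y, hy, hd⟩
    rw [hd, dihedralUnit_r, n1_pow_eq_one_iff, DihedralGroup.r_mul_r, DihedralGroup.r_mul_r,
      add_comm]
    exact ⟨hy, rfl⟩

theorem sum_eq {M : Type*} [AddCommMonoid M] (f : DihedralGroup k → M) :
    ∑ h : ZD l k, f h.right =
      2 ^ l • (∑ y : ZMod k, f (.r y) + ∑ y : ZMod k, f (.sr y)) := by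
  rw [← Fintype.sum_equiv (SemidirectProduct.equivProd (N := Multiplicative (ZMod (2 ^ l)))
    (φ := (unitAut (2 ^ l)).comp (dihedralUnit l k))).symm (fun p => f p.2)
    (fun h : ZD l k => f h.right) (fun _ => rfl), Fintype.sum_prod_type]
  simp only [Finset.sum_const, Finset.card_univ, Fintype.card_multiplicative, ZMod.card]
  congr 1
  rw [← Fintype.sum_equiv (DihedralGroup.equivSum (n := k)).symm
    (fun x => f (DihedralGroup.equivSum.symm x)) f (fun _ => rfl), Fintype.sum_sum_type]
  rfl

theorem card_eq : Nat.card (ZD l k) = 2 ^ l * (2 * k) := by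
  have h := sum_eq (l := l) (k := k) (fun _ => 1)
  simpa [two_mul] using h

theorem card_centralizer {r : ℤ} (hr : Odd r) (i : ℤ) :
    2 * Nat.card (Subgroup.centralizer {a l k ^ r * u l k ^ (2 * i)}) = 2 ^ l * k := by
  classical
  obtain ⟨c, hc⟩ : 4 ∣ k := Fact.out
  -- The centralizer is counted by summing its indicator function, which depends only on the `D_k`
  -- component; half of the `k` rotations are even.
  have h := sum_eq (l := l) (k := k) (fun d => if ∃ y : ZMod k, Even y.val ∧ d = .r y then (1 : ℂ)
    else 0)
  simp only [← mem_centralizer_iff (l := l) hr i, DihedralGroup.r.injEq, exists_eq_right',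
    reduceCtorEq, and_false, exists_false, if_false, Finset.sum_const_zero, add_zero,
    Finset.sum_boole] at h
  have h1 : ∑ y : ZMod k, (if Even y.val then (1 : ℂ) else 0) = (2 * c : ℕ) := by
    rw [sum_zmod_val k (fun j => if Even j then (1 : ℂ) else 0), hc,
      show 4 * c = 2 * (2 * c) by ring, sum_range_two_mul_parity]
    simp
  rw [Finset.sum_boole] at h1
  rw [h1, ← Fintype.card_subtype, nsmul_eq_mul] at h
  rw [Nat.card_eq_fintype_card]
  have h2 : Fintype.card (Subgroup.centralizer {a l k ^ r * u l k ^ (2 * i)}) = 2 ^ l * (2 * c) := by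
    exact_mod_cast h
  rw [h2, hc]
  ring

theorem index_centralizer {r : ℤ} (hr : Odd r) (i : ℤ) :
    (Subgroup.centralizer {a l k ^ r * u l k ^ (2 * i)}).index = 4 := by
  have h1 := (Subgroup.centralizer {a l k ^ r * u l k ^ (2 * i)}).card_mul_index
  have h2 := card_centralizer (l := l) (k := k) hr i
  have h3 : 0 < Nat.card (Subgroup.centralizer {a l k ^ r * u l k ^ (2 * i)}) := Nat.card_pos
  rw [card_eq] at h1
  refine Nat.eq_of_mul_eq_mul_left h3 ?_
  rw [h1]
  linarith

end ZD

/-! ### Evaluation of the indicators. -/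

namespace ZD

variable {l k : ℕ} [Fact (3 ≤ l)] [Fact (4 ∣ k)] [NeZero k]

/-- The generator `u²` of `⟨u²⟩`. -/
def uSq (l k : ℕ) [Fact (3 ≤ l)] [Fact (4 ∣ k)] [NeZero k] : Subgroup.zpowers (u l k ^ 2) :=
  ⟨u l k ^ 2, Subgroup.mem_zpowers _⟩

theorem uSq_zpow_eq_one_iff (z : ℤ) : uSq l k ^ z = 1 ↔ (k : ℤ) ∣ 2 * z := by
  rw [← u_zpow_eq_one_iff (l := l), Subtype.ext_iff, Subgroup.coe_zpow, zpow_mul]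
  rfl

/-- A power of `u²` has trivial component in `⟨a⟩`, so only `β^t` is evaluated. All values needed
below are of this kind, which is why `s` does not affect the indicator. -/
theorem extendByZero_u_pow (α : Subgroup.zpowers (a l k) →* ℂˣ)
    (β : Subgroup.zpowers (u l k ^ 2) →* ℂˣ) {r : ℤ} (hr : Odd r) (i s t : ℤ) (n : ℕ) :
    extendByZero (centralizerPhi α β hr i s t) (u l k ^ (2 * n)) =
      ((β (uSq l k) ^ t) ^ n : ℂˣ) := by
  have hH : u l k ^ (2 * n) ∈ H1 l k := by
    rw [pow_mul]
    exact pow_mem (Subgroup.subset_closure (by simp)) _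
  have hproj : projD l k (u l k ^ (2 * n)) = u l k ^ (2 * n) := by
    simp only [projD, u, MonoidHom.comp_apply, map_pow, SemidirectProduct.rightHom_inr]
  have hA : partA l k ⟨_, hH⟩ = 1 := by
    apply Subtype.ext
    simp [partA, hproj]
  have hU : partU l k ⟨_, hH⟩ = uSq l k ^ n := by
    apply Subtype.ext
    change projD l k (u l k ^ (2 * n)) = (u l k ^ 2) ^ n
    rw [hproj, pow_mul]
  rw [extendByZero_of_mem _ (by rw [centralizer_eq hr]; exact hH)]
  congr 1
  change phi α β s t ⟨u l k ^ (2 * n), hH⟩ = _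
  rw [phi_apply, hA, hU, map_one, one_zpow, one_mul, map_pow]
  rw [← zpow_natCast, zpow_comm, zpow_natCast]

variable (α : Subgroup.zpowers (a l k) →* ℂˣ) (β : Subgroup.zpowers (u l k ^ 2) →* ℂˣ)
  {r : ℤ} (hr : Odd r) (i s t : ℤ)

/-- The contribution of an element of `ℤ_{2^l} ⋊ D_k` with component `d` in `D_k` to the `m`-th
indicator. -/
def indicatorTerm (m : ℕ) (d : DihedralGroup k) : ℂ :=
  if ∑ j ∈ Finset.range m, (dihedralUnit l k d : ZMod (2 ^ l)) ^ j = 0 ∧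
      (d * DihedralGroup.r ((2 * i : ℤ) : ZMod k)) ^ m = d ^ m then
    extendByZero (centralizerPhi α β hr i s t) (SemidirectProduct.inr d ^ m) else 0

/-- Each `d` in `D_k` has `2^l` preimages in the group, and twice the order of the centralizer is
`2^l k`. -/
theorem k_mul_indicator (m : ℕ) :
    (k : ℂ) * DrinfeldDouble.indicator (ZD l k) (OddTypeIModule α β hr i s t) m =
      2 * (∑ y : ZMod k, indicatorTerm α β hr i s t m (.r y) +
        ∑ y : ZMod k, indicatorTerm α β hr i s t m (.sr y)) := by
  have hterm : ∀ h : ZD l k, (if (h * (a l k ^ r * u l k ^ (2 * i))) ^ m = h ^ m then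
      extendByZero (centralizerPhi α β hr i s t) (h ^ m) else 0) =
        indicatorTerm α β hr i s t m h.right := by
    intro h
    rw [indicatorTerm]
    refine ite_congr (propext (mul_pow_eq_pow_iff hr i h m)) (fun hh => ?_) (fun _ => rfl)
    congr 1
    -- The vanishing geometric sum kills the first coordinate of `h^m`, so `h^m` is the image of
    -- `d^m`.
    rw [ext_iff', pow_left_toAdd, pow_right, hh.1, zero_mul, ← map_pow]
    exact ⟨rfl, rfl⟩
  have hcard := card_centralizer (l := l) (k := k) hr i
  have hcard' : 2 * (Nat.card (Subgroup.centralizer {a l k ^ r * u l k ^ (2 * i)}) : ℂ) =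
      2 ^ l * k := by exact_mod_cast hcard
  have h0 : (Nat.card (Subgroup.centralizer {a l k ^ r * u l k ^ (2 * i)}) : ℂ) ≠ 0 :=
    Nat.cast_ne_zero.mpr Nat.card_pos.ne'
  rw [DoubleModule.indicator_eq]
  simp only [hterm]
  rw [sum_eq, nsmul_eq_mul]
  push_cast
  generalize ∑ y : ZMod k, indicatorTerm α β hr i s t m (.r y) +
    ∑ y : ZMod k, indicatorTerm α β hr i s t m (.sr y) = S
  field_simp
  linear_combination -S * hcard'

theorem indicator_of_odd {m : ℕ} (hm : Odd m) :
    DrinfeldDouble.indicator (ZD l k) (OddTypeIModule α β hr i s t) m = 0 := by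
  have hl : l ≠ 0 := by
    obtain ⟨j, hj⟩ := exists_eq_add_three l
    omega
  have hterm : ∀ d : DihedralGroup k, indicatorTerm α β hr i s t m d = 0 := fun d =>
    if_neg fun h => geom_sum_unit_ne_zero hl hm _ h.1
  have h := k_mul_indicator α β hr i s t m
  simp only [hterm, Finset.sum_const_zero, add_zero, mul_zero] at h
  exact (mul_eq_zero.mp h).resolve_left (Nat.cast_ne_zero.mpr (NeZero.ne k))

/-- Even powers of reflections are `1`, so the `D_k` condition is automatic and the character is
evaluated at `1`. -/
theorem indicatorTerm_sr (n : ℕ) (y : ZMod k) :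
    indicatorTerm α β hr i s t (2 * n) (.sr y) =
      if Even y.val then (if 2 ∣ n then 1 else 0) else 1 := by
  have h1 : ∀ z : ZMod k, (DihedralGroup.sr z) ^ (2 * n) = 1 := fun z => by
    rw [pow_mul, pow_two, DihedralGroup.sr_mul_self, one_pow]
  have h2 : extendByZero (centralizerPhi α β hr i s t) 1 = 1 := by
    rw [extendByZero_of_mem _ (one_mem _)]
    exact congrArg Units.val (map_one (centralizerPhi α β hr i s t))
  rw [indicatorTerm, DihedralGroup.sr_mul_r, ← map_pow, h1, h1, map_one, h2]
  simp only [and_true, dihedralUnit_sr, geom_sum_reflection_eq_zero_iff]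
  by_cases hy : Even y.val <;> simp [hy]

/-- In `2n(y + 2i) = 2ny` the `y` cancels, so the condition is the same for all rotations and the
values form a geometric progression in `y`. -/
theorem indicatorTerm_r (n : ℕ) (y : ZMod k) :
    indicatorTerm α β hr i s t (2 * n) (.r y) =
      if 2 ^ l ∣ 2 * n ∧ (k : ℤ) ∣ 2 * (2 * n : ℕ) * i then
        (((β (uSq l k) ^ t) ^ n : ℂˣ) : ℂ) ^ y.val else 0 := by
  have h1 : (SemidirectProduct.inr (DihedralGroup.r y) : ZD l k) ^ (2 * n) =
      u l k ^ (2 * (n * y.val)) := by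
    rw [inr_r_eq, ← pow_mul]
    congr 1
    ring
  have h2 : ((2 * i : ℤ) : ZMod k) * ((2 * n : ℕ) : ZMod k) =
      ((2 * (2 * n : ℕ) * i : ℤ) : ZMod k) := by
    push_cast
    ring
  rw [indicatorTerm, h1, extendByZero_u_pow, pow_mul _ n, Units.val_pow_eq_pow_val _ y.val]
  refine if_congr (and_congr (geom_sum_rotation_eq_zero_iff n y.val) ?_) rfl rfl
  rw [DihedralGroup.r_mul_r, DihedralGroup.r_pow, DihedralGroup.r_pow, DihedralGroup.r.injEq,
    add_mul, add_eq_left, h2, ZMod.intCast_zmod_eq_zero_iff_dvd]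

/-- The three summands come from the rotations, the reflections with even `y` and those with odd
`y`. -/
theorem indicator_two_mul
    (hβ : ∀ χ : Subgroup.zpowers (u l k ^ 2) →* ℂˣ, χ ∈ Subgroup.zpowers β) (n : ℕ) :
    DrinfeldDouble.indicator (ZD l k) (OddTypeIModule α β hr i s t) (2 * n) =
      (if 2 ^ l ∣ 2 * n ∧ (k : ℤ) ∣ 2 * (2 * n : ℕ) * i ∧ (k : ℤ) ∣ (2 * n : ℕ) * t
        then 2 else 0) + ((if 2 ∣ n then 1 else 0) + 1) := by
  have hk : (k : ℂ) ≠ 0 := Nat.cast_ne_zero.mpr (NeZero.ne k)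
  refine mul_left_cancel₀ hk ?_
  rw [k_mul_indicator]
  simp only [indicatorTerm_r, indicatorTerm_sr]
  have hsr : ∑ y : ZMod k, (if Even y.val then (if 2 ∣ n then (1 : ℂ) else 0) else 1) =
      k / 2 * ((if 2 ∣ n then 1 else 0) + 1) := by
    obtain ⟨c, hc⟩ : 4 ∣ k := Fact.out
    rw [sum_zmod_val k (fun j => if Even j then (if 2 ∣ n then (1 : ℂ) else 0) else 1)]
    rw [show k = 2 * (2 * c) by omega, sum_range_two_mul_parity]
    push_cast
    ring
  -- `β` is injective, so the ratio `β(u²)^{tn}` of the progression is `1` exactly when `u^{2tn} =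
  -- 1`.
  have hζ : (β (uSq l k) ^ t) ^ n = 1 ↔ (k : ℤ) ∣ (2 * n : ℕ) * t := by
    rw [← zpow_natCast, ← zpow_mul, ← map_zpow,
      map_eq_one_iff _ (generator_monoidHom_injective hβ), uSq_zpow_eq_one_iff]
    push_cast
    rw [show 2 * (t * n) = 2 * n * t by ring]
  have hζk : (((β (uSq l k) ^ t) ^ n : ℂˣ) : ℂ) ^ k = 1 := by
    have h1 : uSq l k ^ k = 1 := by
      rw [← zpow_natCast (uSq l k), uSq_zpow_eq_one_iff]
      exact dvd_mul_left _ _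
    rw [← Units.val_pow_eq_pow_val, ← pow_mul, ← zpow_natCast, ← zpow_mul, mul_comm t,
      Nat.cast_mul, mul_comm (n : ℤ), mul_assoc, zpow_mul, zpow_natCast, ← map_pow, h1, map_one,
      one_zpow, Units.val_one]
  have hr' : ∑ y : ZMod k, (if 2 ^ l ∣ 2 * n ∧ (k : ℤ) ∣ 2 * (2 * n : ℕ) * i then
        (((β (uSq l k) ^ t) ^ n : ℂˣ) : ℂ) ^ y.val else 0) =
      if 2 ^ l ∣ 2 * n ∧ (k : ℤ) ∣ 2 * (2 * n : ℕ) * i ∧ (k : ℤ) ∣ (2 * n : ℕ) * t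
        then (k : ℂ) else 0 := by
    by_cases h : 2 ^ l ∣ 2 * n ∧ (k : ℤ) ∣ 2 * (2 * n : ℕ) * i
    · simp only [if_pos h]
      rw [sum_zmod_val k (fun j => (((β (uSq l k) ^ t) ^ n : ℂˣ) : ℂ) ^ j),
        geom_sum_root_of_unity hζk]
      refine if_congr ?_ rfl rfl
      rw [Units.val_eq_one, hζ, ← and_assoc, and_iff_right h]
    · simp only [if_neg h, Finset.sum_const_zero]
      rw [if_neg (fun h' => h ⟨h'.1, h'.2.1⟩)]
  rw [hr', hsr]
  generalize (if 2 ∣ n then (1 : ℂ) else 0) = c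
  split_ifs <;> ring

end ZD

end DoubleIndicator

end

/-! ### The table of values. -/

theorem mainTheorem11 (l k : ℕ) [Fact (3 ≤ l)] [Fact (4 ∣ k)] [NeZero k]
    (α : Subgroup.zpowers (DoubleIndicator.ZD.a l k) →* ℂˣ)
    (hα : ∀ χ : Subgroup.zpowers (DoubleIndicator.ZD.a l k) →* ℂˣ, χ ∈ Subgroup.zpowers α)
    (β : Subgroup.zpowers (DoubleIndicator.ZD.u l k ^ 2) →* ℂˣ)
    (hβ : ∀ χ : Subgroup.zpowers (DoubleIndicator.ZD.u l k ^ 2) →* ℂˣ, χ ∈ Subgroup.zpowers β)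
    (r i s t : ℤ) (hr : Odd r) (m : ℕ) (hm : 1 < m) :
    Module.finrank ℂ (DoubleIndicator.ZD.OddTypeIModule α β hr i s t) = 4 ∧
    IsSimpleModule (DoubleIndicator.DrinfeldDouble (DoubleIndicator.ZD l k))
      (DoubleIndicator.ZD.OddTypeIModule α β hr i s t) ∧
    (2 ^ l ∣ m ∧ (k : ℤ) ∣ 2 * m * i ∧ (k : ℤ) ∣ m * t →
      DoubleIndicator.DrinfeldDouble.indicator (DoubleIndicator.ZD l k)
        (DoubleIndicator.ZD.OddTypeIModule α β hr i s t) m = 4) ∧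
    (4 ∣ m ∧ (¬ 2 ^ l ∣ m ∨ ¬ (k : ℤ) ∣ 2 * m * i ∨ ¬ (k : ℤ) ∣ m * t) →
      DoubleIndicator.DrinfeldDouble.indicator (DoubleIndicator.ZD l k)
        (DoubleIndicator.ZD.OddTypeIModule α β hr i s t) m = 2) ∧
    (2 ∣ m ∧ ¬ 4 ∣ m →
      DoubleIndicator.DrinfeldDouble.indicator (DoubleIndicator.ZD l k)
        (DoubleIndicator.ZD.OddTypeIModule α β hr i s t) m = 1) ∧
    (¬ 2 ∣ m →
      DoubleIndicator.DrinfeldDouble.indicator (DoubleIndicator.ZD l k)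
        (DoubleIndicator.ZD.OddTypeIModule α β hr i s t) m = 0) ∧
    DoubleIndicator.DrinfeldDouble.indicator (DoubleIndicator.ZD l k)
      (DoubleIndicator.ZD.OddTypeIModule α β hr i s t) 2 = 1 := by
  open DoubleIndicator DoubleIndicator.ZD in
  have heven : ∀ m : ℕ, 2 ∣ m → DrinfeldDouble.indicator (ZD l k) (OddTypeIModule α β hr i s t) m =
      (if 2 ^ l ∣ m ∧ (k : ℤ) ∣ 2 * m * i ∧ (k : ℤ) ∣ m * t then 2 else 0) +
        ((if 4 ∣ m then 1 else 0) + 1) := by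
    rintro _ ⟨n, rfl⟩
    rw [indicator_two_mul α β hr i s t hβ n, show 4 = 2 * 2 by norm_num]
    simp only [Nat.mul_dvd_mul_iff_left two_pos]
  -- Hence the rotations contribute only when `4 ∣ m`, and the even case takes just the values `2 +
  -- 1 + 1`, `0 + 1 + 1` and `0 + 0 + 1`.
  have h4 : 4 ∣ 2 ^ l := by
    obtain ⟨j, rfl⟩ := DoubleIndicator.ZD.exists_eq_add_three l
    exact ⟨2 ^ (j + 1), by ring⟩
  refine ⟨?_, DoubleIndicator.DoubleModule.isSimpleModule _, ?_, ?_, ?_, ?_, ?_⟩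
  · rw [DoubleIndicator.DoubleModule.finrank_eq, DoubleIndicator.ZD.index_centralizer hr]
  · intro h
    have hm4 : 4 ∣ m := h4.trans h.1
    rw [heven m (by omega), if_pos h, if_pos hm4]
    norm_num
  · rintro ⟨hm4, h⟩
    rw [heven m (by omega), if_neg (by tauto), if_pos hm4]
    norm_num
  · rintro ⟨hm2, hm4⟩
    rw [heven m hm2, if_neg (fun h => hm4 (h4.trans h.1)), if_neg hm4]
    norm_num
  · intro hm2
    exact DoubleIndicator.ZD.indicator_of_odd α β hr i s t
      (Nat.not_even_iff_odd.mp fun h => hm2 (even_iff_two_dvd.mp h))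
  · rw [heven 2 dvd_rfl, if_neg (fun h => absurd (h4.trans h.1) (by norm_num)),
      if_neg (by norm_num)]
    norm_num
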